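/- Let $N\in\mathbb N$, let $|\cdot|$ be the Euclidean norm on $\mathbb R^N$, let $(\mathbb R^N)^+=\{x\in\mathbb R^N: x_i\ge 0 \text{ for all } i\}$ with the induced metric, and write $x\le y$ for the componentwise order. Let $f:\mathbb R\times\mathbb R^N\to\mathbb R^N$ be a Lipschitz Carathéodory function ($f\in\mathfrak{LC}$): $f$ is Borel measurable, and for every compact $K\subset\mathbb R^N$ there are real functions $m^K,l^K\in L^1_{loc}(\mathbb R)$ such that, for almost every $t\in\mathbb R$, $|f(t,x)|\le m^K(t)$ and $|f(t,x)-f(t,y)|\le l^K(t)\,|x-y|$ for all $x,y\in K$. Assume: (A1) if $x\ge 0$ and $x_i=0$, then $f_i(t,x)\ge 0$ for a.e. $t\in\mathbb R$; (A2) $f(t,x)\le A(t)x+b(t)$ for a.e. $(t,x)\in\mathbb R\times(\mathbb R^N)^+$, where $A=[a_{ij}]\in L^1_{loc}(\mathbb R,\mathbb R^{N\times N})$ has $a_{ij}\ge 0$ almost everywhere for all $i\ne j$, and $b\in L^1_{loc}(\mathbb R,\mathbb R^N)$ satisfies $b(t)\ge 0$ for every $t$; (A3) there are $\alpha_1>0$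 and $K\ge 1$ with $\|\Phi(t)\Phi^{-1}(s)\|\le K e^{-\alpha_1(t-s)}$ for all $s\le t\le 0$, where $\Phi$ is the fundamental matrix solution of $\dot y=A(t)y$ with $\Phi(0)=I$; (A4) for every $r>0$, $\sup_{t\in\mathbb R}\int_{-r}^{r}|b(u+t)|\,du<\infty$. Then for every $s\in\mathbb R$ and $x_0\in(\mathbb R^N)^+$ the Carathéodory Cauchy problem $\dot x=f(t,x)$, $x(s)=x_0$, has a unique forward solution, it is defined on $[s,\infty)$ and remains in $(\mathbb R^N)^+$, and, denoting by $S(t,s)x_0$ its value at time $t\ge s$, $S$ is a process on $X=(\mathbb R^N)^+$: $S(t,t)=\mathrm{id}$, $S(t,s)=S(t,r)S(r,s)$ for $t\ge r\ge s$, and $(t,s,x)\mapsto S(t,s)x$ is continuous on $\{t\ge s\}\times X$. Moreover: (i) For every $\tau\in\mathbb R$, $S$ is strongly pullback bounded dissipative on $(-\infty,\tau]$: there is a family $\{B(t)\}_{t\in\mathbb R}$ of nonempty bounded subsets of $X$ such that for every $t\in\mathbb R$ and every bounded $D\subset X$ there is $T(t,D)>0$ with $S(t,t-s)D\subset B(t)$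 for all $s\ge T(t,D)$, and such that for every bounded $D\subset X$ there is $T'(\tau,D)>0$ with $S(t,t-s)D\subset B(\tau)$ for all $t\le\tau$ and all $s\ge T'(\tau,D)$. (ii) $S$ has a pullback attractor $\{\mathcal A(t)\}_{t\in\mathbb R}$ that is bounded in the past. That is: each $\mathcal A(t)\subset X$ is compact; $S(t,s)\mathcal A(s)=\mathcal A(t)$ for $t\ge s$; for every $t$ and every bounded $D\subset X$, $\lim_{s\to-\infty}\sup_{x\in S(t,s)D}\inf_{y\in\mathcal A(t)}|x-y|=0$; $\mathcal A(t)\subset C(t)$ for all $t$ whenever $\{C(t)\}_{t\in\mathbb R}$ is a family of closed subsets of $X$ with this attraction property; and $\bigcup_{t\le\tau}\mathcal A(t)$ is bounded for every $\tau\in\mathbb R$. -/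

import Mathlib

open MeasureTheory Filter Topology
open scoped ENNReal

noncomputable section

namespace PullbackCone

/-! ### Processes and pullback attractors on a metric space -/

section PullbackDynamics

variable {X : Type*} [MetricSpace X]

/-- A process on `X`. Only the values `S t s` with `s ≤ t` are meaningful. -/
structure IsProcess (S : ℝ → ℝ → X → X) : Prop where
  self : ∀ (t : ℝ) (x : X), S t t x = x
  comp : ∀ (s r t : ℝ), s ≤ r → r ≤ t → ∀ x : X, S t s x = S t r (S r s x)
  cont : ContinuousOn (fun p : ℝ × ℝ × X => S p.1 p.2.1 p.2.2) {p | p.2.1 ≤ p.1}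

/-- The Hausdorff semi-distance `sup_{x ∈ A} inf_{y ∈ B} d(x, y)`, with values in `[0, ∞]`. -/
def semiDist (A B : Set X) : ℝ≥0∞ := ⨆ x ∈ A, Metric.infEDist x B

/-- The family `𝒜` pullback attracts every bounded set, at every time `t`. -/
def PullbackAttracts (S : ℝ → ℝ → X → X) (𝒜 : ℝ → Set X) : Prop :=
  ∀ (t : ℝ) (D : Set X), Bornology.IsBounded D →
    Tendsto (fun s : ℝ => semiDist (S t s '' D) (𝒜 t)) atBot (𝓝 0)

/-- Pullback attractor: compact, invariant, pullback attracting, and minimal among the families of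
closed sets that pullback attract bounded sets. -/
structure IsPullbackAttractor (S : ℝ → ℝ → X → X) (𝒜 : ℝ → Set X) : Prop where
  compact : ∀ t : ℝ, IsCompact (𝒜 t)
  invariant : ∀ s t : ℝ, s ≤ t → S t s '' 𝒜 s = 𝒜 t
  attracts : PullbackAttracts S 𝒜
  minimal : ∀ C : ℝ → Set X, (∀ t : ℝ, IsClosed (C t)) → PullbackAttracts S C →
    ∀ t : ℝ, 𝒜 t ⊆ C t

/-- A family is bounded in the past when its union over each half-line `(-∞, τ]` is bounded. -/
def BoundedInPast (𝒜 : ℝ → Set X) : Prop :=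
  ∀ τ : ℝ, Bornology.IsBounded (⋃ t ∈ Set.Iic τ, 𝒜 t)

/-- `B` is a pullback bounded absorbing family of the process `S`. -/
structure IsPullbackAbsorbing (S : ℝ → ℝ → X → X) (B : ℝ → Set X) : Prop where
  nonempty : ∀ t : ℝ, (B t).Nonempty
  bounded : ∀ t : ℝ, Bornology.IsBounded (B t)
  absorbs : ∀ (t : ℝ) (D : Set X), Bornology.IsBounded D →
    ∃ T : ℝ, 0 < T ∧ ∀ s : ℝ, T ≤ s → S t (t - s) '' D ⊆ B t

/-- `S` is strongly pullback bounded dissipative on `(-∞, τ]`. -/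
def StronglyPullbackBoundedDissipative (S : ℝ → ℝ → X → X) (τ : ℝ) : Prop :=
  ∃ B : ℝ → Set X, IsPullbackAbsorbing S B ∧
    ∀ D : Set X, Bornology.IsBounded D →
      ∃ T : ℝ, 0 < T ∧ ∀ t s : ℝ, t ≤ τ → T ≤ s → S t (t - s) '' D ⊆ B τ

end PullbackDynamics

/-! ### Carathéodory equations -/

/-- `ℝ^N` with its Euclidean norm. -/
abbrev E (N : ℕ) : Type := EuclideanSpace ℝ (Fin N)

/-- The positive cone `(ℝ^N)⁺`, with the metric induced from `ℝ^N`. -/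
abbrev Cone (N : ℕ) : Type := {x : E N // ∀ i : Fin N, 0 ≤ x i}

/-- Lipschitz Carathéodory functions `f : ℝ × ℝ^N → ℝ^N`. -/
structure IsLC {N : ℕ} (f : ℝ → E N → E N) : Prop where
  measurable : Measurable (fun p : ℝ × E N => f p.1 p.2)
  mBound : ∀ K : Set (E N), IsCompact K → ∃ m : ℝ → ℝ, LocallyIntegrable m volume ∧
    ∀ᵐ t : ℝ, ∀ x ∈ K, ‖f t x‖ ≤ m t
  lBound : ∀ K : Set (E N), IsCompact K → ∃ l : ℝ → ℝ, LocallyIntegrable l volume ∧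
    ∀ᵐ t : ℝ, ∀ x ∈ K, ∀ y ∈ K, ‖f t x - f t y‖ ≤ l t * ‖x - y‖

/-- `x` is, on the interval `J` with left end point `s ∈ J`, a Carathéodory solution of
`x' = f(t, x)`, `x(s) = x₀`. -/
structure IsSolutionOn {N : ℕ} (f : ℝ → E N → E N) (s : ℝ) (x₀ : E N) (J : Set ℝ)
    (x : ℝ → E N) : Prop where
  cont : ContinuousOn x J
  integrable : ∀ t ∈ J, IntervalIntegrable (fun u : ℝ => f u (x u)) volume s t
  eqn : ∀ t ∈ J, x t = x₀ + ∫ u in s..t, f u (x u)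

/-- `S` is the process on the positive cone induced by `x' = f(t, x)`: for every `s` and every
`x₀ ≥ 0` the function `t ↦ S t s x₀` is the solution on `[s, ∞)` that starts at time `s` from `x₀`,
and every solution of the same Cauchy problem in `ℝ^N`, on any `[s, T]`, coincides with it. -/
structure IsInducedProcess {N : ℕ} (f : ℝ → E N → E N) (S : ℝ → ℝ → Cone N → Cone N) : Prop where
  process : IsProcess S
  solution : ∀ (s : ℝ) (x₀ : Cone N),
    IsSolutionOn f s (x₀ : E N) (Set.Ici s) (fun t : ℝ => (S t s x₀ : E N))
  unique : ∀ (s T : ℝ) (x₀ : Cone N) (y : ℝ → E N),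
    IsSolutionOn f s (x₀ : E N) (Set.Icc s T) y → ∀ t ∈ Set.Icc s T, y t = (S t s x₀ : E N)

/-! ### The hypotheses on the vector field -/

/-- If `x ≥ 0` and `x_i = 0`, then `f_i(t, x) ≥ 0` for almost every `t`. -/
def CondA1 {N : ℕ} (f : ℝ → E N → E N) : Prop :=
  ∀ (x : E N) (i : Fin N), (∀ j : Fin N, 0 ≤ x j) → x i = 0 → ∀ᵐ t : ℝ, 0 ≤ f t x i

/-- `f(t, x) ≤ A(t) x + b(t)` componentwise for almost every `(t, x)` with `x ≥ 0`, where `A`, `b`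
are locally integrable, `A` has nonnegative off-diagonal entries and `b ≥ 0`. -/
structure CondA2 {N : ℕ} (f : ℝ → E N → E N) (A : ℝ → Matrix (Fin N) (Fin N) ℝ)
    (b : ℝ → E N) : Prop where
  locInt_A : ∀ i j : Fin N, LocallyIntegrable (fun t : ℝ => A t i j) volume
  quasiMonotone : ∀ i j : Fin N, i ≠ j → ∀ᵐ t : ℝ, 0 ≤ A t i j
  locInt_b : LocallyIntegrable b volume
  nonneg_b : ∀ (t : ℝ) (i : Fin N), 0 ≤ b t i
  le : ∀ᵐ p : ℝ × E N, (∀ j : Fin N, 0 ≤ p.2 j) →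
    ∀ i : Fin N, f p.1 p.2 i ≤ (∑ j : Fin N, A p.1 i j * p.2 j) + b p.1 i

/-- `Φ` is the fundamental matrix solution of `y' = A(t) y` with `Φ(0) = I`. -/
structure IsFundamentalMatrix {N : ℕ} (A Φ : ℝ → Matrix (Fin N) (Fin N) ℝ) : Prop where
  cont : Continuous Φ
  eqn : ∀ (t : ℝ) (i j : Fin N),
    Φ t i j = (1 : Matrix (Fin N) (Fin N) ℝ) i j + ∫ u in (0 : ℝ)..t, (A u * Φ u) i j

/-- `y' = A(t) y` has exponential dichotomy on `(-∞, 0]` with projection the identity. The norm is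
the operator norm associated with the Euclidean norm. -/
def CondA3 {N : ℕ} (A : ℝ → Matrix (Fin N) (Fin N) ℝ) : Prop :=
  ∃ Φ : ℝ → Matrix (Fin N) (Fin N) ℝ, IsFundamentalMatrix A Φ ∧
    ∃ α₁ K : ℝ, 0 < α₁ ∧ 1 ≤ K ∧ ∀ s t : ℝ, s ≤ t → t ≤ 0 →
      ‖Matrix.toEuclideanCLM (n := Fin N) (𝕜 := ℝ) (Φ t * (Φ s)⁻¹)‖
        ≤ K * Real.exp (-α₁ * (t - s))

/-- The set of the translates `b_t = b(· + t)`, `t ∈ ℝ`, is bounded in `L¹_loc`. -/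
def CondA4 {N : ℕ} (b : ℝ → E N) : Prop :=
  ∀ r : ℝ, 0 < r → ∃ C : ℝ, ∀ t : ℝ, (∫ u in (-r)..r, ‖b (u + t)‖) ≤ C

end PullbackCone

end

noncomputable section

namespace PullbackCone

/-!
Cutting `f` off outside a large box makes it globally Lipschitz, with a locally integrable Lipschitz
constant, so Picard iteration gives a solution. By (A1) it stays in the cone, and there (A2) bounds
the sum of its coordinates a priori, so that for a large enough box the cut-off is never active on a
given bounded time interval. Gronwall's inequality gives uniqueness and continuous dependence.

For `s ≤ t ≤ 0` the solution is compared componentwise, by quasi-monotonicity, with that of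
`y' = A(t) y + b(t)`. Variation of constants, (A3) and (A4) bound the latter by
`K e^{-α₁ (t - s)} |x₀|` plus a constant, whence a ball that absorbs every bounded set uniformly for
the final times `t ≤ 0`. Its image under the flow over `[0, τ]` is bounded, which extends the
absorption to the final times `t ≤ τ`. The attractor is the pullback omega-limit of absorbing sets.
-/

section AbsoluteContinuity

open Set

theorem absolutelyContinuousOnInterval_congr {X : Type*} [PseudoMetricSpace X] {f g : ℝ → X}
    {a b : ℝ} (hf : AbsolutelyContinuousOnInterval f a b) (hfg : EqOn f g (uIcc a b)) :
    AbsolutelyContinuousOnInterval g a b := by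
  rw [absolutelyContinuousOnInterval_iff] at hf ⊢
  intro ε hε
  obtain ⟨δ, hδ, hsum⟩ := hf ε hε
  refine ⟨δ, hδ, fun I hI hIδ => (Finset.sum_congr rfl fun i hi => ?_).trans_lt (hsum I hI hIδ)⟩
  rw [hfg (hI.1 i hi).1, hfg (hI.1 i hi).2]

theorem absolutelyContinuousOnInterval_comp_lipschitzOnWith {X Y : Type*} [PseudoMetricSpace X]
    [PseudoMetricSpace Y] {f : ℝ → X} {g : X → Y} {a b : ℝ} {K : NNReal}
    (hg : LipschitzOnWith K g (f '' uIcc a b)) (hf : AbsolutelyContinuousOnInterval f a b) :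
    AbsolutelyContinuousOnInterval (fun t => g (f t)) a b := by
  rw [absolutelyContinuousOnInterval_iff] at hf ⊢
  intro ε hε
  obtain ⟨δ, hδ, hsum⟩ := hf (ε / (K + 1)) (by positivity)
  refine ⟨δ, hδ, fun I hI hIδ => ?_⟩
  calc ∑ i ∈ Finset.range I.1, dist (g (f (I.2 i).1)) (g (f (I.2 i).2))
      ≤ ∑ i ∈ Finset.range I.1, K * dist (f (I.2 i).1) (f (I.2 i).2) :=
        Finset.sum_le_sum fun i hi => hg.dist_le_mul _ (mem_image_of_mem _ (hI.1 i hi).1) _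
          (mem_image_of_mem _ (hI.1 i hi).2)
    _ = K * ∑ i ∈ Finset.range I.1, dist (f (I.2 i).1) (f (I.2 i).2) :=
        (Finset.mul_sum _ _ _).symm
    _ ≤ K * (ε / (K + 1)) := by gcongr; exact (hsum I hI hIδ).le
    _ < ε := by
        rw [mul_div_assoc', div_lt_iff₀ (by positivity)]
        linarith

theorem absolutelyContinuousOnInterval_exp {f : ℝ → ℝ} {a b : ℝ}
    (hf : AbsolutelyContinuousOnInterval f a b) :
    AbsolutelyContinuousOnInterval (fun t => Real.exp (f t)) a b := by
  obtain ⟨C, hC⟩ := hf.exists_bound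
  obtain ⟨K, hK⟩ := Real.contDiff_exp.contDiffOn (n := 1) (s := Icc (-C) C)
    |>.exists_lipschitzOnWith one_ne_zero (convex_Icc _ _) isCompact_Icc
  refine absolutelyContinuousOnInterval_comp_lipschitzOnWith (hK.mono ?_) hf
  rintro _ ⟨t, ht, rfl⟩
  exact abs_le.1 (hC t ht)

end AbsoluteContinuity

/-! ### Primitives of integrable functions -/

section Primitive

open Set

/-- The function `w` is absolutely continuous on `[a, b]` with derivative `φ` almost everywhere,
expressed through the integral equation so that it makes sense in every normed space. This is the
notion of differentiability underlying Carathéodory solutions. -/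
structure IsPrimitiveOn {F : Type*} [NormedAddCommGroup F] [NormedSpace ℝ F] (w φ : ℝ → F)
    (a b : ℝ) : Prop where
  intervalIntegrable : IntervalIntegrable φ volume a b
  eq_add_integral : ∀ t ∈ Icc a b, w t = w a + ∫ u in a..t, φ u

theorem intervalIntegrable_of_mem_Icc {F : Type*} [NormedAddCommGroup F] {φ : ℝ → F}
    {a b c d : ℝ} (hφ : IntervalIntegrable φ volume a b) (hc : c ∈ Icc a b) (hd : d ∈ Icc a b) :
    IntervalIntegrable φ volume c d :=
  hφ.mono_set (uIcc_subset_uIcc (Icc_subset_uIcc hc) (Icc_subset_uIcc hd))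

theorem intervalIntegrable_of_locallyIntegrable {F : Type*} [NormedAddCommGroup F] {φ : ℝ → F}
    (hφ : LocallyIntegrable φ volume) (a b : ℝ) : IntervalIntegrable φ volume a b :=
  (hφ.integrableOn_isCompact isCompact_uIcc).intervalIntegrable

theorem locallyIntegrable_norm {F : Type*} [NormedAddCommGroup F] {φ : ℝ → F}
    (hφ : LocallyIntegrable φ volume) : LocallyIntegrable (fun t => ‖φ t‖) volume :=
  hφ.mono hφ.aestronglyMeasurable.norm (ae_of_all _ fun _ => (norm_norm _).le)

theorem integral_le_integral_of_Icc_subset {g : ℝ → ℝ} (hg : LocallyIntegrable g volume)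
    (hg_nonneg : ∀ t, 0 ≤ g t) {a b c d : ℝ} (hac : a ≤ c) (hcd : c ≤ d) (hdb : d ≤ b) :
    ∫ u in c..d, g u ≤ ∫ u in a..b, g u :=
  intervalIntegral.integral_mono_interval hac hcd hdb (ae_of_all _ hg_nonneg)
    (intervalIntegrable_of_locallyIntegrable hg a b)

namespace IsPrimitiveOn

variable {F G : Type*} [NormedAddCommGroup F] [NormedSpace ℝ F] [NormedAddCommGroup G]
  [NormedSpace ℝ G] {w w₁ w₂ φ φ₁ φ₂ : ℝ → F} {a b c d : ℝ}

theorem const_add_integral (hφ : IntervalIntegrable φ volume a b) (x : F) :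
    IsPrimitiveOn (fun t => x + ∫ u in a..t, φ u) φ a b :=
  ⟨hφ, fun t _ => by simp⟩

theorem eq_add_integral_of_mem (h : IsPrimitiveOn w φ a b) (hc : c ∈ Icc a b) (hd : d ∈ Icc a b) :
    w d = w c + ∫ u in c..d, φ u := by
  have ha : a ∈ Icc a b := left_mem_Icc.2 (hc.1.trans hc.2)
  rw [h.eq_add_integral d hd, h.eq_add_integral c hc, add_assoc,
    intervalIntegral.integral_add_adjacent_intervals
      (intervalIntegrable_of_mem_Icc h.intervalIntegrable ha hc)
      (intervalIntegrable_of_mem_Icc h.intervalIntegrable hc hd)]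

theorem mono (h : IsPrimitiveOn w φ a b) (hc : c ∈ Icc a b) (hd : d ∈ Icc a b) :
    IsPrimitiveOn w φ c d :=
  ⟨intervalIntegrable_of_mem_Icc h.intervalIntegrable hc hd,
    fun _ ht => h.eq_add_integral_of_mem hc ⟨hc.1.trans ht.1, ht.2.trans hd.2⟩⟩

theorem congr (h : IsPrimitiveOn w₁ φ₁ a b) (hw : EqOn w₁ w₂ (Icc a b))
    (hφ : EqOn φ₁ φ₂ (Icc a b)) (hab : a ≤ b) : IsPrimitiveOn w₂ φ₂ a b := by
  have ha : a ∈ Icc a b := left_mem_Icc.2 hab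
  have hφ' {t : ℝ} (ht : t ∈ Icc a b) : EqOn φ₁ φ₂ (uIcc a t) := by
    rw [uIcc_of_le ht.1]
    exact hφ.mono (Icc_subset_Icc_right ht.2)
  refine ⟨h.intervalIntegrable.congr ((hφ' (right_mem_Icc.2 hab)).mono uIoc_subset_uIcc),
    fun t ht => ?_⟩
  rw [← hw ht, ← hw ha, h.eq_add_integral t ht, intervalIntegral.integral_congr (hφ' ht)]

theorem continuousOn (h : IsPrimitiveOn w φ a b) : ContinuousOn w (Icc a b) := by
  have hcont := intervalIntegral.continuousOn_primitive_interval' h.intervalIntegrable left_mem_uIcc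
  exact ((hcont.mono Icc_subset_uIcc).const_add (w a)).congr h.eq_add_integral

theorem sub (h₁ : IsPrimitiveOn w₁ φ₁ a b) (h₂ : IsPrimitiveOn w₂ φ₂ a b) :
    IsPrimitiveOn (fun t => w₁ t - w₂ t) (fun t => φ₁ t - φ₂ t) a b := by
  refine ⟨h₁.intervalIntegrable.sub h₂.intervalIntegrable, fun t ht => ?_⟩
  have ha : a ∈ Icc a b := left_mem_Icc.2 (ht.1.trans ht.2)
  rw [intervalIntegral.integral_sub (intervalIntegrable_of_mem_Icc h₁.intervalIntegrable ha ht)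
    (intervalIntegrable_of_mem_Icc h₂.intervalIntegrable ha ht), h₁.eq_add_integral t ht,
    h₂.eq_add_integral t ht]
  abel

theorem add (h₁ : IsPrimitiveOn w₁ φ₁ a b) (h₂ : IsPrimitiveOn w₂ φ₂ a b) :
    IsPrimitiveOn (fun t => w₁ t + w₂ t) (fun t => φ₁ t + φ₂ t) a b := by
  refine ⟨h₁.intervalIntegrable.add h₂.intervalIntegrable, fun t ht => ?_⟩
  have ha : a ∈ Icc a b := left_mem_Icc.2 (ht.1.trans ht.2)
  rw [intervalIntegral.integral_add (intervalIntegrable_of_mem_Icc h₁.intervalIntegrable ha ht)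
    (intervalIntegrable_of_mem_Icc h₂.intervalIntegrable ha ht), h₁.eq_add_integral t ht,
    h₂.eq_add_integral t ht]
  abel

theorem sum {ι : Type*} (s : Finset ι) {w φ : ι → ℝ → F}
    (h : ∀ i ∈ s, IsPrimitiveOn (w i) (φ i) a b) :
    IsPrimitiveOn (fun t => ∑ i ∈ s, w i t) (fun t => ∑ i ∈ s, φ i t) a b := by
  classical
  induction s using Finset.induction_on with
  | empty => exact ⟨by simp, fun t _ => by simp⟩
  | insert i s hi ih =>
    simp only [Finset.sum_insert hi]
    exact (h i (s.mem_insert_self i)).add (ih fun j hj => h j (Finset.mem_insert_of_mem hj))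

theorem clm_apply [CompleteSpace F] [CompleteSpace G] (h : IsPrimitiveOn w φ a b) (L : F →L[ℝ] G) :
    IsPrimitiveOn (fun t => L (w t)) (fun t => L (φ t)) a b := by
  refine ⟨⟨L.integrable_comp h.intervalIntegrable.1, L.integrable_comp h.intervalIntegrable.2⟩,
    fun t ht => ?_⟩
  have ha : a ∈ Icc a b := left_mem_Icc.2 (ht.1.trans ht.2)
  rw [L.intervalIntegral_comp_comm (intervalIntegrable_of_mem_Icc h.intervalIntegrable ha ht),
    h.eq_add_integral t ht, map_add]

end IsPrimitiveOn

namespace IsPrimitiveOn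

variable {w w₁ w₂ φ φ₁ φ₂ : ℝ → ℝ} {a b : ℝ}

theorem absolutelyContinuousOnInterval (h : IsPrimitiveOn w φ a b) (hab : a ≤ b) :
    AbsolutelyContinuousOnInterval w a b := by
  have hconst : AbsolutelyContinuousOnInterval (fun _ => w a) a b :=
    (LipschitzWith.const (w a)).lipschitzOnWith.absolutelyContinuousOnInterval
  refine absolutelyContinuousOnInterval_congr (hconst.add
    (h.intervalIntegrable.absolutelyContinuousOnInterval_intervalIntegral left_mem_uIcc)) ?_
  rw [uIcc_of_le hab]
  exact fun t ht => (h.eq_add_integral t ht).symm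

theorem ae_hasDerivAt (h : IsPrimitiveOn w φ a b) :
    ∀ᵐ t, t ∈ Ioo a b → HasDerivAt w (φ t) t := by
  filter_upwards [h.intervalIntegrable.ae_hasDerivAt_integral] with t hderiv ht
  refine ((hderiv (Icc_subset_uIcc (Ioo_subset_Icc_self ht)) a left_mem_uIcc).const_add
    (w a)).congr_of_eventuallyEq ?_
  filter_upwards [Icc_mem_nhds ht.1 ht.2] with u hu using h.eq_add_integral u hu

theorem of_ae_hasDerivAt (hab : a ≤ b) (hw : AbsolutelyContinuousOnInterval w a b)
    (hderiv : ∀ᵐ t, t ∈ Ioo a b → HasDerivAt w (φ t) t) : IsPrimitiveOn w φ a b := by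
  have hae : deriv w =ᵐ[volume.restrict (uIoc a b)] φ := by
    rw [uIoc_of_le hab, ← restrict_Ioo_eq_restrict_Ioc]
    refine (ae_restrict_iff' measurableSet_Ioo).2 ?_
    filter_upwards [hderiv] with t ht htab using (ht htab).deriv
  refine ⟨hw.intervalIntegrable_deriv.congr_ae hae, fun t ht => ?_⟩
  have hsub : uIcc a t ⊆ uIcc a b := uIcc_subset_uIcc left_mem_uIcc (Icc_subset_uIcc ht)
  have hae_t : deriv w =ᵐ[volume.restrict (uIoc a t)] φ :=
    ae_restrict_of_ae_restrict_of_subset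
      (by rw [uIoc_of_le ht.1, uIoc_of_le hab]; exact Ioc_subset_Ioc_right ht.2) hae
  rw [← intervalIntegral.integral_congr_ae_restrict hae_t, (hw.mono hsub).integral_deriv_eq_sub]
  ring

theorem mul (hab : a ≤ b) (h₁ : IsPrimitiveOn w₁ φ₁ a b) (h₂ : IsPrimitiveOn w₂ φ₂ a b) :
    IsPrimitiveOn (fun t => w₁ t * w₂ t) (fun t => φ₁ t * w₂ t + w₁ t * φ₂ t) a b := by
  refine of_ae_hasDerivAt hab ((h₁.absolutelyContinuousOnInterval hab).mul
    (h₂.absolutelyContinuousOnInterval hab)) ?_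
  filter_upwards [h₁.ae_hasDerivAt, h₂.ae_hasDerivAt] with t hd₁ hd₂ ht
  exact (hd₁ ht).mul (hd₂ ht)

theorem exp (hab : a ≤ b) (h : IsPrimitiveOn w φ a b) :
    IsPrimitiveOn (fun t => Real.exp (w t)) (fun t => Real.exp (w t) * φ t) a b := by
  refine of_ae_hasDerivAt hab
    (absolutelyContinuousOnInterval_exp (h.absolutelyContinuousOnInterval hab)) ?_
  filter_upwards [h.ae_hasDerivAt] with t hd ht using (hd ht).exp

theorem right_le_left (hab : a ≤ b) (h : IsPrimitiveOn w φ a b)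
    (hφ : ∀ᵐ t, t ∈ Icc a b → φ t ≤ 0) : w b ≤ w a := by
  rw [h.eq_add_integral b (right_mem_Icc.2 hab), add_le_iff_nonpos_right]
  have hφ' : φ ≤ᵐ[volume.restrict (Icc a b)] fun _ => 0 :=
    (ae_restrict_iff' measurableSet_Icc).2 hφ
  simpa only [intervalIntegral.integral_zero] using
    intervalIntegral.integral_mono_ae_restrict hab h.intervalIntegrable (by simp) hφ'

end IsPrimitiveOn

end Primitive

section Gronwall

open Set

variable {l v : ℝ → ℝ} {a b : ℝ}

theorem le_mul_exp_integral_of_le_add_integral {c : ℝ} (hab : a ≤ b)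
    (hl : IntervalIntegrable l volume a b) (hl_nonneg : ∀ t ∈ Icc a b, 0 ≤ l t)
    (hv : ContinuousOn v (Icc a b)) (hle : ∀ t ∈ Icc a b, v t ≤ c + ∫ u in a..t, l u * v u) :
    v b ≤ c * Real.exp (∫ u in a..b, l u) := by
  set H : ℝ → ℝ := fun t => c + ∫ u in a..t, l u * v u
  set Λ : ℝ → ℝ := fun t => ∫ u in a..t, l u
  have hH : IsPrimitiveOn H (fun u => l u * v u) a b :=
    .const_add_integral (hl.mul_continuousOn (by rwa [uIcc_of_le hab])) c
  have hΛ : IsPrimitiveOn (fun t => -Λ t) (fun u => -l u) a b := by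
    simpa only [intervalIntegral.integral_neg, zero_add] using
      IsPrimitiveOn.const_add_integral (φ := fun u => -l u) hl.neg 0
  have hdecr : H b * Real.exp (-Λ b) ≤ c := by
    refine ((hH.mul hab (hΛ.exp hab)).right_le_left hab (ae_of_all _ fun t ht => ?_)).trans_eq ?_
    · calc l t * v t * Real.exp (-Λ t) + H t * (Real.exp (-Λ t) * -l t)
          = l t * Real.exp (-Λ t) * (v t - H t) := by ring
        _ ≤ 0 := mul_nonpos_of_nonneg_of_nonpos
            (mul_nonneg (hl_nonneg t ht) (Real.exp_pos _).le) (sub_nonpos.2 (hle t ht))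
    · simp [H, Λ]
  calc v b ≤ H b := hle b (right_mem_Icc.2 hab)
    _ ≤ c * Real.exp (Λ b) := by
        rwa [Real.exp_neg, ← div_eq_mul_inv, div_le_iff₀ (Real.exp_pos _)] at hdecr

theorem IsPrimitiveOn.le_mul_exp_integral {φ β : ℝ → ℝ} (hv : IsPrimitiveOn v φ a b) (hab : a ≤ b)
    (hl : IntervalIntegrable l volume a b) (hl_nonneg : ∀ t ∈ Icc a b, 0 ≤ l t)
    (hβ : IntervalIntegrable β volume a b) (hβ_nonneg : ∀ t ∈ Icc a b, 0 ≤ β t)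
    (hφ : ∀ᵐ t, t ∈ Icc a b → φ t ≤ β t + l t * v t) :
    v b ≤ (v a + ∫ u in a..b, β u) * Real.exp (∫ u in a..b, l u) := by
  refine le_mul_exp_integral_of_le_add_integral hab hl hl_nonneg hv.continuousOn fun t ht => ?_
  have ha : a ∈ Icc a b := left_mem_Icc.2 hab
  have hlv : IntervalIntegrable (fun u => l u * v u) volume a b :=
    hl.mul_continuousOn (by rw [uIcc_of_le hab]; exact hv.continuousOn)
  have hβt := intervalIntegrable_of_mem_Icc hβ ha ht
  have hlvt := intervalIntegrable_of_mem_Icc hlv ha ht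
  have hφ_le : ∫ u in a..t, φ u ≤ ∫ u in a..t, (β u + l u * v u) := by
    refine intervalIntegral.integral_mono_ae_restrict ht.1
      (intervalIntegrable_of_mem_Icc hv.intervalIntegrable ha ht) (hβt.add hlvt) ?_
    refine (ae_restrict_iff' measurableSet_Icc).2 ?_
    filter_upwards [hφ] with u hu hut using hu ⟨hut.1, hut.2.trans ht.2⟩
  have hβ_le : ∫ u in a..t, β u ≤ ∫ u in a..b, β u :=
    intervalIntegral.integral_mono_interval le_rfl ht.1 ht.2
      ((ae_restrict_iff' measurableSet_Ioc).2 (ae_of_all _ fun u hu =>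
        hβ_nonneg u (Ioc_subset_Icc_self hu))) hβ
  rw [intervalIntegral.integral_add hβt hlvt] at hφ_le
  rw [hv.eq_add_integral t ht]
  linarith

namespace IsPrimitiveOn

variable {F : Type*} [NormedAddCommGroup F] [NormedSpace ℝ F] {w w' φ φ' : ℝ → F} {m : ℝ → ℝ}
  {c s s' t : ℝ}

theorem norm_sub_le_integral (hw : IsPrimitiveOn w φ a b) (hab : a ≤ b)
    (hm : IntervalIntegrable m volume a b) (hle : ∀ᵐ u, u ∈ Icc a b → ‖φ u‖ ≤ m u) :
    ‖w b - w a‖ ≤ ∫ u in a..b, m u := by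
  rw [hw.eq_add_integral b (right_mem_Icc.2 hab), add_sub_cancel_left]
  refine intervalIntegral.norm_integral_le_of_norm_le hab ?_ hm
  filter_upwards [hle] with u hu hut using hu (Ioc_subset_Icc_self hut)

theorem norm_sub_le_mul_exp_integral (hw : IsPrimitiveOn w φ a b) (hw' : IsPrimitiveOn w' φ' a b)
    (hab : a ≤ b) (hl : IntervalIntegrable l volume a b) (hl_nonneg : ∀ t ∈ Icc a b, 0 ≤ l t)
    (hle : ∀ᵐ u, u ∈ Icc a b → ‖φ u - φ' u‖ ≤ l u * ‖w u - w' u‖) :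
    ‖w b - w' b‖ ≤ ‖w a - w' a‖ * Real.exp (∫ u in a..b, l u) := by
  have hsub := hw.sub hw'
  refine le_mul_exp_integral_of_le_add_integral (v := fun t => ‖w t - w' t‖) hab hl hl_nonneg
    hsub.continuousOn.norm fun t ht => ?_
  have ha : a ∈ Icc a b := left_mem_Icc.2 hab
  have hl_norm : IntervalIntegrable (fun u => l u * ‖w u - w' u‖) volume a b :=
    hl.mul_continuousOn (by rw [uIcc_of_le hab]; exact hsub.continuousOn.norm)
  have hincr := (hsub.mono ha ht).norm_sub_le_integral ht.1
    (intervalIntegrable_of_mem_Icc hl_norm ha ht)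
    (hle.mono fun u hu hut => hu ⟨hut.1, hut.2.trans ht.2⟩)
  calc ‖w t - w' t‖ ≤ ‖w a - w' a‖ + ‖w t - w' t - (w a - w' a)‖ := norm_le_norm_add_norm_sub' _ _
    _ ≤ ‖w a - w' a‖ + ∫ u in a..t, l u * ‖w u - w' u‖ := by gcongr

theorem norm_sub_max_le_of_le (hw : IsPrimitiveOn w φ s c) (hw' : IsPrimitiveOn w' φ' s' c)
    (hs : s ≤ s') (hs' : s' ≤ c) (hst : s ≤ t) (htc : t ≤ c)
    (hm : LocallyIntegrable m volume) (hm_nonneg : ∀ t, 0 ≤ m t)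
    (hl : LocallyIntegrable l volume) (hl_nonneg : ∀ t, 0 ≤ l t)
    (hφ : ∀ᵐ u, u ∈ Icc s c → ‖φ u‖ ≤ m u)
    (hφφ' : ∀ᵐ u, u ∈ Icc s' c → ‖φ u - φ' u‖ ≤ l u * ‖w u - w' u‖) (has : a ≤ s) :
    ‖w t - w' (max t s')‖ ≤
      (‖w s - w' s'‖ + ∫ u in s..s', m u) * Real.exp (∫ u in a..c, l u) := by
  have hs_mem : s ∈ Icc s c := left_mem_Icc.2 (hs.trans hs')
  have hstart {r : ℝ} (hsr : s ≤ r) (hr : r ≤ s') :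
      ‖w r - w' s'‖ ≤ ‖w s - w' s'‖ + ∫ u in s..s', m u := by
    have hincr : ‖w r - w s‖ ≤ ∫ u in s..r, m u :=
      (hw.mono hs_mem ⟨hsr, hr.trans hs'⟩).norm_sub_le_integral hsr
        (intervalIntegrable_of_locallyIntegrable hm s r)
        (hφ.mono fun u hu hur => hu ⟨hur.1, hur.2.trans (hr.trans hs')⟩)
    calc ‖w r - w' s'‖ ≤ ‖w s - w' s'‖ + ‖w r - w s‖ := by
          rw [add_comm]; exact norm_sub_le_norm_sub_add_norm_sub _ _ _
      _ ≤ ‖w s - w' s'‖ + ∫ u in s..s', m u := by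
          gcongr
          exact hincr.trans (integral_le_integral_of_Icc_subset hm hm_nonneg le_rfl hsr hr)
  have hstart_nonneg := (norm_nonneg _).trans (hstart hs le_rfl)
  rcases le_total s' t with hs't | hts'
  · rw [max_eq_left hs't]
    have ht : t ∈ Icc s' c := ⟨hs't, htc⟩
    refine ((hw.mono ⟨hs, hs'⟩ ⟨hst, htc⟩).norm_sub_le_mul_exp_integral
      (hw'.mono (left_mem_Icc.2 hs') ht) hs't (intervalIntegrable_of_locallyIntegrable hl s' t)
      (fun u _ => hl_nonneg u) (hφφ'.mono fun u hu hut => hu ⟨hut.1, hut.2.trans htc⟩)).trans ?_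
    gcongr
    · exact hstart hs le_rfl
    · exact integral_le_integral_of_Icc_subset hl hl_nonneg (has.trans hs) hs't htc
  · rw [max_eq_right hts']
    refine (hstart hst hts').trans (le_mul_of_one_le_right hstart_nonneg (Real.one_le_exp ?_))
    exact intervalIntegral.integral_nonneg (has.trans (hst.trans htc)) fun u _ => hl_nonneg u

theorem norm_sub_max_le (hw : IsPrimitiveOn w φ s c) (hw' : IsPrimitiveOn w' φ' s' c)
    (hs : s ≤ c) (hs' : s' ≤ c) (htc : t ≤ c)
    (hm : LocallyIntegrable m volume) (hm_nonneg : ∀ t, 0 ≤ m t)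
    (hl : LocallyIntegrable l volume) (hl_nonneg : ∀ t, 0 ≤ l t)
    (hφ : ∀ᵐ u, u ∈ Icc s c → ‖φ u‖ ≤ m u) (hφ' : ∀ᵐ u, u ∈ Icc s' c → ‖φ' u‖ ≤ m u)
    (hφφ' : ∀ᵐ u, u ∈ Icc s c → u ∈ Icc s' c → ‖φ u - φ' u‖ ≤ l u * ‖w u - w' u‖)
    (has : a ≤ s) (has' : a ≤ s') :
    ‖w (max t s) - w' (max t s')‖ ≤
      (‖w s - w' s'‖ + |∫ u in s..s', m u|) * Real.exp (∫ u in a..c, l u) := by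
  rcases le_total s s' with hss' | hs's
  · have hle := norm_sub_max_le_of_le hw hw' hss' hs' (le_max_right t s) (max_le htc hs) hm
      hm_nonneg hl hl_nonneg hφ
      (hφφ'.mono fun u hu hu' => hu ⟨hss'.trans hu'.1, hu'.2⟩ hu') has
    rw [max_assoc, max_eq_right hss'] at hle
    exact hle.trans (by gcongr; exact le_abs_self _)
  · have hle := norm_sub_max_le_of_le hw' hw hs's hs (le_max_right t s') (max_le htc hs') hm
      hm_nonneg hl hl_nonneg hφ' (hφφ'.mono fun u hu hu' => by
        rw [norm_sub_rev, norm_sub_rev (w' u)]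
        exact hu hu' ⟨hs's.trans hu'.1, hu'.2⟩) has'
    rw [max_assoc, max_eq_right hs's] at hle
    rw [norm_sub_rev, norm_sub_rev (w s), intervalIntegral.integral_symm, abs_neg]
    exact hle.trans (by gcongr; exact le_abs_self _)

end IsPrimitiveOn

end Gronwall

/-! ### Carathéodory equations with a globally Lipschitz right-hand side -/

section Picard

open Set

variable {F : Type*} [NormedAddCommGroup F] [NormedSpace ℝ F] {l : ℝ → ℝ} {s t T : ℝ}

theorem integral_mul_exp_integral (hst : s ≤ t) (hl : IntervalIntegrable l volume s t) :
    ∫ u in s..t, l u * Real.exp (∫ r in s..u, l r) = Real.exp (∫ r in s..t, l r) - 1 := by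
  have hprim : IsPrimitiveOn (fun u => ∫ r in s..u, l r) l s t := by
    simpa only [zero_add] using IsPrimitiveOn.const_add_integral hl 0
  have hexp := (hprim.exp hst).eq_add_integral t (right_mem_Icc.2 hst)
  simp only [intervalIntegral.integral_same, Real.exp_zero] at hexp
  simp only [hexp, mul_comm (l _), add_sub_cancel_left]

theorem norm_integral_sub_le_mul_exp {φ ψ : ℝ → F} {M : ℝ} (hst : s ≤ t)
    (hl : LocallyIntegrable l volume) (hM : 0 ≤ M)
    (hφ : IntervalIntegrable φ volume s t) (hψ : IntervalIntegrable ψ volume s t)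
    (hle : ∀ᵐ u, u ∈ Icc s t → ‖φ u - ψ u‖ ≤ l u * (M * Real.exp (∫ r in s..u, 2 * l r))) :
    ‖(∫ u in s..t, φ u) - ∫ u in s..t, ψ u‖ ≤ 1 / 2 * M * Real.exp (∫ r in s..t, 2 * l r) := by
  have h2l : ∀ a b, IntervalIntegrable (fun u => 2 * l u) volume a b := fun a b =>
    (intervalIntegrable_of_locallyIntegrable hl a b).const_mul 2
  have hbound_int : IntervalIntegrable
      (fun u => 1 / 2 * M * (2 * l u * Real.exp (∫ r in s..u, 2 * l r))) volume s t :=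
    ((h2l s t).mul_continuousOn (Real.continuous_exp.comp
      (intervalIntegral.continuous_primitive h2l s)).continuousOn).const_mul _
  rw [← intervalIntegral.integral_sub hφ hψ]
  calc ‖∫ u in s..t, (φ u - ψ u)‖
      ≤ ∫ u in s..t, 1 / 2 * M * (2 * l u * Real.exp (∫ r in s..u, 2 * l r)) := by
        refine intervalIntegral.norm_integral_le_of_norm_le hst ?_ hbound_int
        filter_upwards [hle] with u hu hut
        exact (hu (Ioc_subset_Icc_self hut)).trans_eq (by ring)
    _ = 1 / 2 * M * (Real.exp (∫ r in s..t, 2 * l r) - 1) := by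
        rw [intervalIntegral.integral_const_mul, integral_mul_exp_integral hst (h2l s t)]
    _ ≤ 1 / 2 * M * Real.exp (∫ r in s..t, 2 * l r) := by gcongr; linarith

variable [CompleteSpace F]

theorem exists_fixedPoint_of_weighted_contraction (hsT : s ≤ T) {lam : ℝ → ℝ}
    (hlam : Continuous lam) {P : (ℝ → F) → ℝ → F} (hP : ∀ x, Continuous x → Continuous (P x))
    {κ : NNReal} (hκ : κ < 1)
    (hcontr : ∀ x y, Continuous x → Continuous y → ∀ M, 0 ≤ M →
      (∀ u ∈ Icc s T, ‖x u - y u‖ ≤ M * Real.exp (lam u)) →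
      ∀ t ∈ Icc s T, ‖P x t - P y t‖ ≤ κ * M * Real.exp (lam t)) :
    ∃ x, Continuous x ∧ ∀ t ∈ Icc s T, P x t = x t := by
  let lift (z : C(Icc s T, F)) (u : ℝ) : F := Real.exp (lam u) • z (projIcc s T hsT u)
  have hlift (z : C(Icc s T, F)) : Continuous (lift z) :=
    (Real.continuous_exp.comp hlam).smul (z.continuous.comp continuous_projIcc)
  let Q (z : C(Icc s T, F)) : C(Icc s T, F) :=
    ⟨fun t => Real.exp (-lam t) • P (lift z) t, ((Real.continuous_exp.comp hlam.neg).smul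
      (hP _ (hlift z))).comp continuous_subtype_val⟩
  have hQ : ContractingWith κ Q := by
    refine ⟨hκ, LipschitzWith.of_dist_le_mul fun z w => ?_⟩
    rw [ContinuousMap.dist_le (by positivity)]
    intro t
    have hzw : ∀ u ∈ Icc s T, ‖lift z u - lift w u‖ ≤ dist z w * Real.exp (lam u) := fun u _ => by
      rw [← smul_sub, norm_smul, Real.norm_of_nonneg (Real.exp_pos _).le, ← dist_eq_norm, mul_comm]
      gcongr
      exact ContinuousMap.dist_apply_le_dist _
    calc dist (Q z t) (Q w t) = Real.exp (-lam t) * ‖P (lift z) t - P (lift w) t‖ := by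
          simp only [Q, ContinuousMap.coe_mk]
          rw [dist_eq_norm, ← smul_sub, norm_smul, Real.norm_of_nonneg (Real.exp_pos _).le]
      _ ≤ Real.exp (-lam t) * (κ * dist z w * Real.exp (lam t)) := by
          gcongr
          exact hcontr _ _ (hlift z) (hlift w) _ dist_nonneg hzw t t.2
      _ = κ * dist z w := by rw [mul_left_comm, ← Real.exp_add, neg_add_cancel, Real.exp_zero,
          mul_one]
  obtain ⟨z, hz⟩ : ∃ z, Q z = z := ⟨_, hQ.fixedPoint_isFixedPt⟩
  refine ⟨lift z, hlift z, fun t ht => ?_⟩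
  have hzt : Real.exp (-lam t) • P (lift z) t = z ⟨t, ht⟩ := congrArg (· ⟨t, ht⟩) hz
  simp only [lift, projIcc_of_mem hsT ht, ← hzt, smul_smul, ← Real.exp_add, add_neg_cancel,
    Real.exp_zero, one_smul]

theorem exists_isPrimitiveOn_of_lipschitz {g : ℝ → F → F} (hsT : s ≤ T)
    (hl : LocallyIntegrable l volume) (hl_nonneg : ∀ t, 0 ≤ l t)
    (hg : ∀ x : ℝ → F, Continuous x → LocallyIntegrable (fun u => g u (x u)) volume)
    (hg_lip : ∀ᵐ t, ∀ x y, ‖g t x - g t y‖ ≤ l t * ‖x - y‖) (x₀ : F) :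
    ∃ x : ℝ → F, x s = x₀ ∧ IsPrimitiveOn x (fun u => g u (x u)) s T := by
  have hg_int (x : ℝ → F) (hx : Continuous x) := intervalIntegrable_of_locallyIntegrable (hg x hx)
  have hlam : Continuous fun t => ∫ r in s..t, 2 * l r :=
    intervalIntegral.continuous_primitive
      (fun a b => (intervalIntegrable_of_locallyIntegrable hl a b).const_mul 2) s
  obtain ⟨x, hx, hfix⟩ := exists_fixedPoint_of_weighted_contraction hsT hlam
    (P := fun x t => x₀ + ∫ u in s..t, g u (x u)) (κ := 1 / 2)
    (fun x hx => continuous_const.add (intervalIntegral.continuous_primitive (hg_int x hx) s))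
    (by rw [← NNReal.coe_lt_coe]; norm_num) (fun x y hx hy M hM hxy t ht => by
      simp only [add_sub_add_left_eq_sub, NNReal.coe_div, NNReal.coe_one, NNReal.coe_ofNat]
      refine norm_integral_sub_le_mul_exp ht.1 hl hM (hg_int x hx s t) (hg_int y hy s t) ?_
      filter_upwards [hg_lip] with u hu hut
      exact (hu _ _).trans
        (mul_le_mul_of_nonneg_left (hxy u ⟨hut.1, hut.2.trans ht.2⟩) (hl_nonneg u)))
  have hxs : x s = x₀ := by simpa using (hfix s (left_mem_Icc.2 hsT)).symm
  exact ⟨x, hxs, hg_int x hx s T, fun t ht => by rw [hxs, hfix t ht]⟩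

end Picard

/-! ### Invariance of the positive cone under quasi-monotone systems -/

section QuasiMonotone

open Set

theorem negPart_le_integral_of_neg_le {w φ ψ : ℝ → ℝ} {s t : ℝ} (hst : s ≤ t)
    (hw : IsPrimitiveOn w φ s t) (hws : 0 ≤ w s) (hψ : IntervalIntegrable ψ volume s t)
    (hψ_nonneg : ∀ u ∈ Icc s t, 0 ≤ ψ u)
    (hle : ∀ᵐ u, u ∈ Icc s t → w u ≤ 0 → -ψ u ≤ φ u) : (w t)⁻ ≤ ∫ u in s..t, ψ u := by
  have hs : s ∈ Icc s t := left_mem_Icc.2 hst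
  have ht : t ∈ Icc s t := right_mem_Icc.2 hst
  refine sup_le ?_ (intervalIntegral.integral_nonneg hst hψ_nonneg)
  -- After the last time `r` at which `w` is nonnegative, `w` decreases at rate at most `ψ`.
  obtain ⟨r, ⟨hr, hwr : 0 ≤ w r⟩, hr_last⟩ :=
    (isCompact_Icc.of_isClosed_subset (hw.continuousOn.preimage_isClosed_of_isClosed isClosed_Icc
      (isClosed_Ici (a := (0 : ℝ)))) inter_subset_left).exists_isGreatest ⟨s, hs, hws⟩
  have hψ_rt := intervalIntegrable_of_mem_Icc hψ hr ht
  have hdecay : -∫ u in r..t, ψ u ≤ ∫ u in r..t, φ u := by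
    rw [← intervalIntegral.integral_neg]
    refine intervalIntegral.integral_mono_ae_restrict hr.2 hψ_rt.neg
      (intervalIntegrable_of_mem_Icc hw.intervalIntegrable hr ht) ?_
    rw [← restrict_Ioc_eq_restrict_Icc]
    refine (ae_restrict_iff' measurableSet_Ioc).2 ?_
    filter_upwards [hle] with u hu hut
    have hu_mem : u ∈ Icc s t := ⟨hr.1.trans hut.1.le, hut.2⟩
    refine hu hu_mem (not_lt.1 fun hpos => ?_)
    exact (hr_last ⟨hu_mem, hpos.le⟩).not_gt hut.1
  have hsplit := intervalIntegral.integral_add_adjacent_intervals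
    (intervalIntegrable_of_mem_Icc hψ hs hr) hψ_rt
  have hψ_sr : 0 ≤ ∫ u in s..r, ψ u :=
    intervalIntegral.integral_nonneg hr.1 fun u hu => hψ_nonneg u ⟨hu.1, hu.2.trans hr.2⟩
  have hwt := hw.eq_add_integral_of_mem hr ht
  linarith

variable {ι : Type*} [Fintype ι]

theorem nonneg_of_neg_mul_sum_negPart_le {w φ : ι → ℝ → ℝ} {l : ℝ → ℝ} {s t : ℝ} (hst : s ≤ t)
    (hl : IntervalIntegrable l volume s t) (hl_nonneg : ∀ u ∈ Icc s t, 0 ≤ l u)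
    (hw : ∀ i, IsPrimitiveOn (w i) (φ i) s t) (hws : ∀ i, 0 ≤ w i s)
    (hle : ∀ᵐ u, u ∈ Icc s t → ∀ i, w i u ≤ 0 → -(l u * ∑ j, (w j u)⁻) ≤ φ i u) (i : ι) :
    0 ≤ w i t := by
  have hs : s ∈ Icc s t := left_mem_Icc.2 hst
  set v : ℝ → ℝ := fun u => ∑ j, (w j u)⁻
  have hv_nonneg (u : ℝ) : 0 ≤ v u := Finset.sum_nonneg fun j _ => negPart_nonneg _
  have hv : ContinuousOn v (Icc s t) :=
    continuousOn_finsetSum _ fun j _ => (hw j).continuousOn.neg.sup continuousOn_const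
  have hlv : IntervalIntegrable (fun u => l u * v u) volume s t :=
    hl.mul_continuousOn (by rwa [uIcc_of_le hst])
  have hcoord (j : ι) (r : ℝ) (hr : r ∈ Icc s t) : (w j r)⁻ ≤ ∫ u in s..r, l u * v u := by
    refine negPart_le_integral_of_neg_le hr.1 ((hw j).mono hs hr) (hws j)
      (intervalIntegrable_of_mem_Icc hlv hs hr)
      (fun u hu => mul_nonneg (hl_nonneg u ⟨hu.1, hu.2.trans hr.2⟩) (hv_nonneg u)) ?_
    filter_upwards [hle] with u hu hur using hu ⟨hur.1, hur.2.trans hr.2⟩ j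
  have hv_zero : v t ≤ 0 * Real.exp (∫ u in s..t, Fintype.card ι * l u) := by
    refine le_mul_exp_integral_of_le_add_integral hst (hl.const_mul _)
      (fun u hu => mul_nonneg (Nat.cast_nonneg _) (hl_nonneg u hu)) hv fun r hr => ?_
    calc v r ≤ ∑ _j : ι, ∫ u in s..r, l u * v u := Finset.sum_le_sum fun j _ => hcoord j r hr
      _ = 0 + ∫ u in s..r, Fintype.card ι * l u * v u := by
          simp only [mul_assoc, intervalIntegral.integral_const_mul, Finset.sum_const,
            Finset.card_univ, nsmul_eq_mul, zero_add]
  have hwt : (w i t)⁻ ≤ v t :=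
    Finset.single_le_sum (f := fun j => (w j t)⁻) (fun j _ => negPart_nonneg _) (Finset.mem_univ i)
  exact negPart_eq_zero.1 (le_antisymm (by linarith) (negPart_nonneg _))

/-- The sum of the absolute values of the entries of a matrix, used as a growth rate for the system
`y' = A y` because `∑ i, |(A y) i| ≤ entrySum A * ∑ i, |y i|`. -/
def entrySum (A : Matrix ι ι ℝ) : ℝ := ∑ i, ∑ j, |A i j|

theorem entrySum_nonneg (A : Matrix ι ι ℝ) : 0 ≤ entrySum A :=
  Finset.sum_nonneg fun _ _ => Finset.sum_nonneg fun _ _ => abs_nonneg _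

theorem abs_apply_le_entrySum (A : Matrix ι ι ℝ) (i j : ι) : |A i j| ≤ entrySum A :=
  (Finset.single_le_sum (f := fun j => |A i j|) (fun _ _ => abs_nonneg _)
    (Finset.mem_univ j)).trans
    (Finset.single_le_sum (f := fun i => ∑ j, |A i j|)
      (fun _ _ => Finset.sum_nonneg fun _ _ => abs_nonneg _) (Finset.mem_univ i))

theorem locallyIntegrable_entrySum {A : ℝ → Matrix ι ι ℝ}
    (hA : ∀ i j, LocallyIntegrable (fun t => A t i j) volume) :
    LocallyIntegrable (fun t => entrySum (A t)) volume :=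
  locallyIntegrable_finsetSum _ fun i _ => locallyIntegrable_finsetSum _ fun j _ =>
    locallyIntegrable_norm (hA i j)

theorem neg_entrySum_mul_sum_negPart_le {A : Matrix ι ι ℝ} {i : ι} (hA : ∀ j, i ≠ j → 0 ≤ A i j)
    {x : ι → ℝ} (hxi : x i ≤ 0) : -(entrySum A * ∑ j, (x j)⁻) ≤ ∑ j, A i j * x j := by
  rw [Finset.mul_sum, ← Finset.sum_neg_distrib]
  refine Finset.sum_le_sum fun j _ => ?_
  have hrow := mul_le_mul_of_nonneg_right (abs_apply_le_entrySum A i j) (negPart_nonneg (x j))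
  have hterm : -(|A i j| * (x j)⁻) ≤ A i j * x j := by
    rcases eq_or_ne i j with rfl | hij
    · rw [negPart_of_nonpos hxi, mul_neg, neg_neg]
      exact mul_le_mul_of_nonpos_right (le_abs_self _) hxi
    · rw [abs_of_nonneg (hA j hij), ← mul_neg]
      exact mul_le_mul_of_nonneg_left (neg_le.1 (neg_le_negPart _)) (hA j hij)
  linarith

theorem nonneg_of_quasiMonotone {A : ℝ → Matrix ι ι ℝ}
    (hA : ∀ i j, LocallyIntegrable (fun t => A t i j) volume)
    (hA_quasi : ∀ i j, i ≠ j → ∀ᵐ t, 0 ≤ A t i j) {w φ : ι → ℝ → ℝ} {s t : ℝ} (hst : s ≤ t)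
    (hw : ∀ i, IsPrimitiveOn (w i) (φ i) s t) (hws : ∀ i, 0 ≤ w i s)
    (hle : ∀ᵐ u, u ∈ Icc s t → ∀ i, ∑ j, A u i j * w j u ≤ φ i u) (i : ι) : 0 ≤ w i t := by
  refine nonneg_of_neg_mul_sum_negPart_le hst
    (intervalIntegrable_of_locallyIntegrable (locallyIntegrable_entrySum hA) s t)
    (fun u _ => entrySum_nonneg _) hw hws ?_ i
  have hquasi : ∀ᵐ u, ∀ i j, i ≠ j → 0 ≤ A u i j :=
    ae_all_iff.2 fun i => ae_all_iff.2 fun j => ae_all_iff.2 (hA_quasi i j)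
  filter_upwards [hle, hquasi] with u hu hqu hut i hi
  exact (neg_entrySum_mul_sum_negPart_le (hqu i) hi).trans (hu hut i)

theorem sum_sum_abs_mul_le (A : Matrix ι ι ℝ) {x : ι → ℝ} (hx : ∀ j, 0 ≤ x j) :
    ∑ i, ∑ j, |A i j| * x j ≤ entrySum A * ∑ j, x j := by
  simp only [entrySum, Finset.sum_mul]
  gcongr with i _ j _
  exact Finset.single_le_sum (f := x) (fun k _ => hx k) (Finset.mem_univ j)

/-- A bound on `[a, c]` for the sum of the coordinates of the nonnegative functions `w` with
`w' ≤ |A| w + β` and initial sum at most `V`. -/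
def aprioriBound (A : ℝ → Matrix ι ι ℝ) (β : ℝ → ℝ) (a c V : ℝ) : ℝ :=
  (V + ∫ u in a..c, Fintype.card ι * β u) * Real.exp (∫ u in a..c, entrySum (A u))

theorem sum_le_aprioriBound {A : ℝ → Matrix ι ι ℝ} {β : ℝ → ℝ}
    (hA : ∀ i j, LocallyIntegrable (fun t => A t i j) volume) (hβ : LocallyIntegrable β volume)
    (hβ_nonneg : ∀ t, 0 ≤ β t) {w φ : ι → ℝ → ℝ} {a c s t V : ℝ} (has : a ≤ s) (hst : s ≤ t)
    (htc : t ≤ c) (hw : ∀ i, IsPrimitiveOn (w i) (φ i) s t)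
    (hw_nonneg : ∀ u ∈ Icc s t, ∀ i, 0 ≤ w i u) (hV : ∑ i, w i s ≤ V)
    (hle : ∀ᵐ u, u ∈ Icc s t → ∀ i, φ i u ≤ ∑ j, |A u i j| * w j u + β u) :
    ∑ i, w i t ≤ aprioriBound A β a c V := by
  have hl := locallyIntegrable_entrySum hA
  have hγ_nonneg (u : ℝ) : 0 ≤ Fintype.card ι * β u := mul_nonneg (Nat.cast_nonneg _) (hβ_nonneg u)
  have hγ : LocallyIntegrable (fun u => Fintype.card ι * β u) volume :=
    hβ.smul (Fintype.card ι : ℝ)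
  have hgronwall := (IsPrimitiveOn.sum Finset.univ fun i _ => hw i).le_mul_exp_integral hst
    (intervalIntegrable_of_locallyIntegrable hl s t) (fun u _ => entrySum_nonneg _)
    (intervalIntegrable_of_locallyIntegrable hγ s t) (fun u _ => hγ_nonneg u) <| by
      filter_upwards [hle] with u hu hut
      calc ∑ i, φ i u ≤ ∑ i, (∑ j, |A u i j| * w j u + β u) := by gcongr with i; exact hu hut i
        _ ≤ Fintype.card ι * β u + entrySum (A u) * ∑ j, w j u := by
            rw [Finset.sum_add_distrib, Finset.sum_const, Finset.card_univ, nsmul_eq_mul, add_comm]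
            gcongr
            exact sum_sum_abs_mul_le _ (hw_nonneg u hut)
  have hγ_le := integral_le_integral_of_Icc_subset hγ hγ_nonneg has hst htc
  have hγ_int : 0 ≤ ∫ u in s..t, Fintype.card ι * β u :=
    intervalIntegral.integral_nonneg hst fun u _ => hγ_nonneg u
  have hw_s : 0 ≤ ∑ i, w i s := Finset.sum_nonneg fun i _ => hw_nonneg s (left_mem_Icc.2 hst) i
  refine hgronwall.trans ?_
  unfold aprioriBound
  gcongr
  · linarith
  · exact integral_le_integral_of_Icc_subset hl (fun _ => entrySum_nonneg _) has hst htc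

end QuasiMonotone

/-! ### Carathéodory solutions -/

section Solutions

open Set

variable {N : ℕ} {f : ℝ → E N → E N} {A : ℝ → Matrix (Fin N) (Fin N) ℝ} {b : ℝ → E N}

theorem IsLC.ae_continuous (hf : IsLC f) : ∀ᵐ t, Continuous (f t) := by
  choose l _ hl using fun n : ℕ => hf.lBound _ (isCompact_closedBall (0 : E N) n)
  filter_upwards [ae_all_iff.2 hl] with t ht
  refine continuous_iff_continuousAt.2 fun x => ?_
  obtain ⟨n, hxn⟩ := exists_nat_gt ‖x‖
  have hlip : LipschitzOnWith (l n t).toNNReal (f t) (Metric.closedBall 0 n) :=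
    LipschitzOnWith.of_dist_le_mul fun y hy z hz => by
      rw [dist_eq_norm, dist_eq_norm]
      exact (ht n y hy z hz).trans (by gcongr; exact Real.le_coe_toNNReal _)
  refine hlip.continuousOn.continuousAt (Metric.closedBall_mem_nhds_of_mem ?_)
  rwa [mem_ball_zero_iff]

theorem IsLC.exists_nonneg_mBound (hf : IsLC f) {K : Set (E N)} (hK : IsCompact K) :
    ∃ m : ℝ → ℝ, LocallyIntegrable m volume ∧ (∀ t, 0 ≤ m t) ∧
      ∀ᵐ t, ∀ x ∈ K, ‖f t x‖ ≤ m t := by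
  obtain ⟨m, hm, hmK⟩ := hf.mBound K hK
  refine ⟨fun t => |m t|, locallyIntegrable_norm hm, fun t => abs_nonneg _, ?_⟩
  filter_upwards [hmK] with t ht x hx using (ht x hx).trans (le_abs_self _)

theorem IsLC.exists_nonneg_lBound (hf : IsLC f) {K : Set (E N)} (hK : IsCompact K) :
    ∃ l : ℝ → ℝ, LocallyIntegrable l volume ∧ (∀ t, 0 ≤ l t) ∧
      ∀ᵐ t, ∀ x ∈ K, ∀ y ∈ K, ‖f t x - f t y‖ ≤ l t * ‖x - y‖ := by
  obtain ⟨l, hl, hlK⟩ := hf.lBound K hK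
  refine ⟨fun t => |l t|, locallyIntegrable_norm hl, fun t => abs_nonneg _, ?_⟩
  filter_upwards [hlK] with t ht x hx y hy
  exact (ht x hx y hy).trans (by gcongr; exact le_abs_self _)

theorem IsLC.locallyIntegrable_comp (hf : IsLC f) {K : Set (E N)} (hK : IsCompact K) {x : ℝ → E N}
    (hx : Continuous x) (hxK : ∀ t, x t ∈ K) :
    LocallyIntegrable (fun t => f t (x t)) volume := by
  obtain ⟨m, hm, hmK⟩ := hf.mBound K hK
  refine hm.mono (hf.measurable.comp
    (measurable_id.prodMk hx.measurable)).aestronglyMeasurable ?_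
  filter_upwards [hmK] with t ht using (ht _ (hxK t)).trans (le_abs_self _)

theorem CondA1.ae_nonneg (hf : IsLC f) (hA1 : CondA1 f) :
    ∀ᵐ t, ∀ (x : E N) (i : Fin N), (∀ j, 0 ≤ x j) → x i = 0 → 0 ≤ f t x i := by
  -- By continuity in `x` it is enough to treat a countable dense subset of each face.
  have hface (i : Fin N) :
      ∀ᵐ t, ∀ x : {x : E N // (∀ j, 0 ≤ x j) ∧ x i = 0}, 0 ≤ f t x i := by
    obtain ⟨D, hD_countable, hD_dense⟩ :=
      TopologicalSpace.exists_countable_dense {x : E N // (∀ j, 0 ≤ x j) ∧ x i = 0}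
    have hD : ∀ᵐ t, ∀ x ∈ D, 0 ≤ f t x i :=
      (ae_ball_iff hD_countable).2 fun x _ => hA1 x i x.2.1 x.2.2
    filter_upwards [hD, hf.ae_continuous] with t ht hcont x
    have hclosed : IsClosed {x : {x : E N // (∀ j, 0 ≤ x j) ∧ x i = 0} | 0 ≤ f t x i} :=
      isClosed_le continuous_const (by fun_prop)
    exact hclosed.closure_subset_iff.2 ht (hD_dense x)
  filter_upwards [ae_all_iff.2 hface] with t ht x i hx hxi using ht i ⟨x, hx, hxi⟩

theorem nonneg_subset_closure_pos :
    {x : E N | ∀ i, 0 ≤ x i} ⊆ closure {x : E N | ∀ i, 0 < x i} := fun x hx => by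
  have hcont : Continuous fun ε : ℝ => x + ε • WithLp.toLp 2 fun _ : Fin N => (1 : ℝ) := by
    fun_prop
  have hlim := (hcont.tendsto 0).mono_left (nhdsWithin_le_nhds (s := Ioi 0))
  rw [zero_smul, add_zero] at hlim
  refine mem_closure_of_tendsto hlim ?_
  filter_upwards [self_mem_nhdsWithin] with ε (hε : 0 < ε) i
  simpa using add_pos_of_nonneg_of_pos (hx i) hε

theorem CondA2.ae_le (hf : IsLC f) (hA2 : CondA2 f A b) :
    ∀ᵐ t, ∀ x : E N, (∀ j, 0 ≤ x j) → ∀ i, f t x i ≤ (∑ j, A t i j * x j) + b t i := by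
  filter_upwards [Measure.ae_ae_of_ae_prod hA2.le, hf.ae_continuous] with t ht hcont x hx i
  have hclosed : IsClosed {y : E N | f t y i ≤ (∑ j, A t i j * y j) + b t i} :=
    isClosed_le (by fun_prop) (by fun_prop)
  have hopen : IsOpen {y : E N | ∀ j, 0 < y j} := by
    simp only [ofPred_forall]
    exact isOpen_iInter_of_finite fun j => isOpen_lt continuous_const (by fun_prop)
  have hpos : {y : E N | ∀ j, 0 < y j} ⊆ {y : E N | f t y i ≤ (∑ j, A t i j * y j) + b t i} :=
    ((Measure.dense_of_ae ht).open_subset_closure_inter hopen).trans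
      (hclosed.closure_subset_iff.2 fun y hy => hy.2 (fun j => (hy.1 j).le) i)
  exact hclosed.closure_subset_iff.2 hpos (nonneg_subset_closure_pos hx)

theorem CondA2.ae_le_abs (hf : IsLC f) (hA2 : CondA2 f A b) :
    ∀ᵐ t, ∀ x y : E N, (∀ j, 0 ≤ x j ∧ x j ≤ y j) →
      ∀ i, f t x i ≤ ∑ j, |A t i j| * y j + ‖b t‖ := by
  filter_upwards [hA2.ae_le hf] with t ht x y hxy i
  refine (ht x (fun j => (hxy j).1) i).trans ?_
  gcongr with j
  · exact (hxy j).1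
  · exact le_abs_self _
  · exact (hxy j).2
  · exact (le_abs_self _).trans (PiLp.norm_apply_le (b t) i)

theorem IsPrimitiveOn.apply {w φ : ℝ → E N} {s t : ℝ} (h : IsPrimitiveOn w φ s t) (i : Fin N) :
    IsPrimitiveOn (fun u => w u i) (fun u => φ u i) s t :=
  h.clm_apply (EuclideanSpace.proj i)

theorem IsPrimitiveOn.isSolutionOn {x : ℝ → E N} {s T : ℝ}
    (h : IsPrimitiveOn x (fun u => f u (x u)) s T) : IsSolutionOn f s (x s) (Icc s T) x where
  cont := h.continuousOn
  integrable _ ht := intervalIntegrable_of_mem_Icc h.intervalIntegrable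
    (left_mem_Icc.2 (ht.1.trans ht.2)) ht
  eqn := h.eq_add_integral

namespace IsSolutionOn

variable {s T : ℝ} {x₀ : E N} {x y : ℝ → E N} {J : Set ℝ}

theorem apply_left (h : IsSolutionOn f s x₀ J x) (hs : s ∈ J) : x s = x₀ := by
  simpa using h.eqn s hs

theorem mono {J' : Set ℝ} (h : IsSolutionOn f s x₀ J x) (hJ : J' ⊆ J) :
    IsSolutionOn f s x₀ J' x :=
  ⟨h.cont.mono hJ, fun t ht => h.integrable t (hJ ht), fun t ht => h.eqn t (hJ ht)⟩

theorem isPrimitiveOn (h : IsSolutionOn f s x₀ J x) (hsT : s ≤ T) (hJ : Icc s T ⊆ J) :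
    IsPrimitiveOn x (fun u => f u (x u)) s T where
  intervalIntegrable := h.integrable T (hJ (right_mem_Icc.2 hsT))
  eq_add_integral t ht := by rw [h.apply_left (hJ (left_mem_Icc.2 hsT)), h.eqn t (hJ ht)]

theorem eq_of_isLC (hf : IsLC f) (hsT : s ≤ T) (hx : IsSolutionOn f s x₀ (Icc s T) x)
    (hy : IsSolutionOn f s x₀ (Icc s T) y) : x T = y T := by
  have hs : s ∈ Icc s T := left_mem_Icc.2 hsT
  obtain ⟨l, hl, hl_nonneg, hlK⟩ := hf.exists_nonneg_lBound
    ((isCompact_Icc.image_of_continuousOn hx.cont).union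
      (isCompact_Icc.image_of_continuousOn hy.cont))
  have hgronwall := (hx.isPrimitiveOn hsT Subset.rfl).norm_sub_le_mul_exp_integral
    (hy.isPrimitiveOn hsT Subset.rfl) hsT (intervalIntegrable_of_locallyIntegrable hl s T)
    (fun u _ => hl_nonneg u) <| by
      filter_upwards [hlK] with u hu hut
      exact hu _ (.inl (mem_image_of_mem x hut)) _ (.inr (mem_image_of_mem y hut))
  rw [hx.apply_left hs, hy.apply_left hs, sub_self, norm_zero, zero_mul, norm_le_zero_iff,
    sub_eq_zero] at hgronwall
  exact hgronwall

theorem of_forall_Icc (h : ∀ T, s ≤ T → IsSolutionOn f s x₀ (Icc s T) x) :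
    IsSolutionOn f s x₀ (Ici s) x where
  cont t (ht : s ≤ t) := by
    have hst : s ≤ t + 1 := ht.trans (by linarith)
    refine ((h _ hst).cont t ⟨ht, by linarith⟩).mono_of_mem_nhdsWithin ?_
    exact mem_of_superset (inter_mem_nhdsWithin _ (Iic_mem_nhds (lt_add_one t)))
      fun u hu => ⟨hu.1, hu.2⟩
  integrable t ht := (h t ht).integrable t (right_mem_Icc.2 ht)
  eqn t ht := (h t ht).eqn t (right_mem_Icc.2 ht)

theorem congr (h : IsSolutionOn f s x₀ (Icc s T) x) (hsT : s ≤ T) (hxy : EqOn x y (Icc s T)) :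
    IsSolutionOn f s x₀ (Icc s T) y := by
  have hs : s ∈ Icc s T := left_mem_Icc.2 hsT
  have hprim := (h.isPrimitiveOn hsT Subset.rfl).congr hxy
    (fun u hu => congrArg (f u) (hxy hu)) hsT
  rw [← h.apply_left hs, hxy hs]
  exact hprim.isSolutionOn

end IsSolutionOn

end Solutions

/-! ### Global existence in the cone -/

section Box

open Set

variable {ι : Type*}

theorem norm_le_norm_of_abs_apply_le [Fintype ι] {x y : EuclideanSpace ℝ ι}
    (h : ∀ i, |x i| ≤ |y i|) : ‖x‖ ≤ ‖y‖ := by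
  rw [EuclideanSpace.norm_eq, EuclideanSpace.norm_eq]
  gcongr with i
  exact h i

/-- The vectors with all coordinates in `[0, R]`. -/
def box (ι : Type*) (R : ℝ) : Set (EuclideanSpace ℝ ι) := {x | ∀ i, x i ∈ Icc 0 R}

theorem isCompact_box (R : ℝ) : IsCompact (box ι R) := by
  convert (isCompact_univ_pi fun _ : ι => isCompact_Icc (a := (0 : ℝ)) (b := R)).image
    (PiLp.continuous_toLp 2 _) using 1
  ext x
  exact ⟨fun hx => ⟨fun i => x i, fun i _ => hx i, rfl⟩,
    by rintro ⟨y, hy, rfl⟩ i; exact hy i trivial⟩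

theorem mem_box_of_sum_le [Fintype ι] {x : EuclideanSpace ℝ ι} {R : ℝ} (hx : ∀ i, 0 ≤ x i)
    (hR : ∑ i, x i ≤ R) : x ∈ box ι R := fun i =>
  ⟨hx i, (Finset.single_le_sum (f := x) (fun j _ => hx j) (Finset.mem_univ i)).trans hR⟩

/-- The coordinatewise retraction onto `box ι R`. Composing the right-hand side of an equation with
it makes the local bounds and Lipschitz constants of the equation global. -/
def clamp (R : ℝ) (x : EuclideanSpace ℝ ι) : EuclideanSpace ℝ ι :=
  WithLp.toLp 2 fun i => max 0 (min (x i) R)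

theorem clamp_apply (R : ℝ) (x : EuclideanSpace ℝ ι) (i : ι) :
    clamp R x i = max 0 (min (x i) R) := rfl

theorem clamp_mem_box {R : ℝ} (hR : 0 ≤ R) (x : EuclideanSpace ℝ ι) : clamp R x ∈ box ι R :=
  fun _ => ⟨le_max_left _ _, max_le hR (min_le_right _ _)⟩

theorem clamp_of_mem_box {R : ℝ} {x : EuclideanSpace ℝ ι} (hx : x ∈ box ι R) : clamp R x = x := by
  ext i
  rw [clamp_apply, min_eq_left (hx i).2, max_eq_right (hx i).1]

theorem norm_clamp_sub_clamp_le [Fintype ι] (R : ℝ) (x y : EuclideanSpace ℝ ι) :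
    ‖clamp R x - clamp R y‖ ≤ ‖x - y‖ := by
  refine norm_le_norm_of_abs_apply_le fun i => ?_
  simp only [PiLp.sub_apply, clamp_apply]
  calc |max 0 (min (x i) R) - max 0 (min (y i) R)| ≤ |min (x i) R - min (y i) R| := by
        simpa using abs_max_sub_max_le_max 0 (min (x i) R) 0 (min (y i) R)
    _ ≤ |x i - y i| := by simpa using abs_min_sub_min_le_max (x i) R (y i) R

theorem continuous_clamp (R : ℝ) : Continuous (clamp (ι := ι) R) := by
  unfold clamp
  fun_prop

end Box

section GlobalExistence

open Set

variable {N : ℕ} {f : ℝ → E N → E N} {A : ℝ → Matrix (Fin N) (Fin N) ℝ} {b : ℝ → E N}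
  {s T : ℝ} {x₀ : E N}

theorem IsLC.exists_isPrimitiveOn_clamp (hf : IsLC f) {R : ℝ} (hR : 0 ≤ R) (hsT : s ≤ T)
    (x₀ : E N) :
    ∃ x : ℝ → E N, x s = x₀ ∧ IsPrimitiveOn x (fun u => f u (clamp R (x u))) s T := by
  obtain ⟨l, hl, hl_nonneg, hlK⟩ := hf.exists_nonneg_lBound (isCompact_box R)
  refine exists_isPrimitiveOn_of_lipschitz (g := fun t x => f t (clamp R x)) hsT hl hl_nonneg
    (fun x hx => hf.locallyIntegrable_comp (isCompact_box R) ((continuous_clamp R).comp hx)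
      fun t => clamp_mem_box hR _) ?_ x₀
  filter_upwards [hlK] with t ht x y
  refine (ht _ (clamp_mem_box hR x) _ (clamp_mem_box hR y)).trans ?_
  exact mul_le_mul_of_nonneg_left (norm_clamp_sub_clamp_le R x y) (hl_nonneg t)

theorem CondA1.nonneg_of_isPrimitiveOn_clamp (hf : IsLC f) (hA1 : CondA1 f) {R : ℝ}
    {x : ℝ → E N} (hx : IsPrimitiveOn x (fun u => f u (clamp R (x u))) s T)
    (hxs : ∀ i, 0 ≤ x s i) : ∀ t ∈ Icc s T, ∀ i, 0 ≤ x t i := by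
  intro t ht i
  have hneg : (x t i)⁻ ≤ ∫ _ in s..t, (0 : ℝ) := by
    refine negPart_le_integral_of_neg_le ht.1
      ((hx.mono (left_mem_Icc.2 (ht.1.trans ht.2)) ht).apply i) (hxs i) (by simp)
      (fun _ _ => le_rfl) ?_
    filter_upwards [hA1.ae_nonneg hf] with u hu _ hxi
    rw [neg_zero]
    exact hu _ i (fun j => le_max_left _ _) (max_eq_left ((min_le_left _ _).trans hxi))
  rw [intervalIntegral.integral_zero] at hneg
  exact negPart_eq_zero.1 (hneg.antisymm (negPart_nonneg _))

theorem CondA2.sum_le_aprioriBound (hf : IsLC f) (hA2 : CondA2 f A b) {a c t V : ℝ}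
    {x y : ℝ → E N} (hx : IsPrimitiveOn x (fun u => f u (y u)) s t)
    (hyx : ∀ u ∈ Icc s t, ∀ i, 0 ≤ y u i ∧ y u i ≤ x u i) (has : a ≤ s) (hst : s ≤ t)
    (htc : t ≤ c) (hV : ∑ i, x s i ≤ V) : ∑ i, x t i ≤ aprioriBound A (fun u => ‖b u‖) a c V := by
  refine PullbackCone.sum_le_aprioriBound (w := fun i u => x u i) hA2.locInt_A
    (locallyIntegrable_norm hA2.locInt_b) (fun _ => norm_nonneg _) has hst htc hx.apply
    (fun u hu i => (hyx u hu i).1.trans (hyx u hu i).2) hV ?_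
  filter_upwards [hA2.ae_le_abs hf] with u hu hut using hu _ _ (hyx u hut)

theorem aprioriBound_nonneg {ι : Type*} [Fintype ι] (A : ℝ → Matrix ι ι ℝ) {β : ℝ → ℝ}
    (hβ : ∀ t, 0 ≤ β t) {a c V : ℝ} (hac : a ≤ c) (hV : 0 ≤ V) : 0 ≤ aprioriBound A β a c V :=
  mul_nonneg (add_nonneg hV (intervalIntegral.integral_nonneg hac fun u _ =>
    mul_nonneg (Nat.cast_nonneg _) (hβ u))) (Real.exp_pos _).le

theorem exists_nonneg_isSolutionOn_Icc (hf : IsLC f) (hA1 : CondA1 f) (hA2 : CondA2 f A b)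
    (hsT : s ≤ T) (hx₀ : ∀ i, 0 ≤ x₀ i) :
    ∃ x : ℝ → E N, IsSolutionOn f s x₀ (Icc s T) x ∧ ∀ t ∈ Icc s T, ∀ i, 0 ≤ x t i := by
  set R := aprioriBound A (fun u => ‖b u‖) s T (∑ i, x₀ i)
  have hR : 0 ≤ R := aprioriBound_nonneg A (fun _ => norm_nonneg _) hsT
    (Finset.sum_nonneg fun i _ => hx₀ i)
  obtain ⟨x, rfl, hx⟩ := hf.exists_isPrimitiveOn_clamp hR hsT x₀
  have hx_nonneg := hA1.nonneg_of_isPrimitiveOn_clamp hf hx hx₀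
  have hx_box : ∀ t ∈ Icc s T, x t ∈ box (Fin N) R := fun t ht =>
    mem_box_of_sum_le (hx_nonneg t ht) <| hA2.sum_le_aprioriBound hf
      (hx.mono (left_mem_Icc.2 hsT) ht) (fun u hu i => ⟨le_max_left _ _,
        max_le (hx_nonneg u ⟨hu.1, hu.2.trans ht.2⟩ i) (min_le_left _ _)⟩) le_rfl ht.1 ht.2 le_rfl
  refine ⟨x, (hx.congr (fun _ _ => rfl) (fun u hu => ?_) hsT).isSolutionOn, hx_nonneg⟩
  simp only [clamp_of_mem_box (hx_box u hu)]

theorem exists_nonneg_isSolutionOn_Ici (hf : IsLC f) (hA1 : CondA1 f) (hA2 : CondA2 f A b)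
    (s : ℝ) (hx₀ : ∀ i, 0 ≤ x₀ i) :
    ∃ x : ℝ → E N, IsSolutionOn f s x₀ (Ici s) x ∧ ∀ t ∈ Ici s, ∀ i, 0 ≤ x t i := by
  choose! y hy hy_nonneg using fun (T : ℝ) (hT : s ≤ T) =>
    exists_nonneg_isSolutionOn_Icc hf hA1 hA2 hT hx₀
  refine ⟨fun t => y t t, .of_forall_Icc fun T hT => (hy T hT).congr hT fun t ht => ?_,
    fun t ht => hy_nonneg t ht t (right_mem_Icc.2 ht)⟩
  exact ((hy T hT).mono (Icc_subset_Icc_right ht.2)).eq_of_isLC hf ht.1 (hy t ht.1)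

end GlobalExistence

/-! ### The induced process -/

section InducedProcess

open Set

variable {N : ℕ} {f : ℝ → E N → E N} {A : ℝ → Matrix (Fin N) (Fin N) ℝ} {b : ℝ → E N}

theorem CondA2.mem_box_of_isSolutionOn (hf : IsLC f) (hA2 : CondA2 f A b) {s a c V : ℝ}
    {x₀ : E N} {x : ℝ → E N} (hx : IsSolutionOn f s x₀ (Ici s) x)
    (hx_nonneg : ∀ t ∈ Ici s, ∀ i, 0 ≤ x t i) (has : a ≤ s) (hV : ∑ i, x₀ i ≤ V) :
    ∀ t ∈ Icc s c, x t ∈ box (Fin N) (aprioriBound A (fun u => ‖b u‖) a c V) := by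
  intro t ht
  refine mem_box_of_sum_le (hx_nonneg t ht.1) (hA2.sum_le_aprioriBound hf
    (hx.isPrimitiveOn ht.1 Icc_subset_Ici_self) (fun u hu i => ⟨hx_nonneg u hu.1 i, le_rfl⟩) has
    ht.1 ht.2 ?_)
  rwa [hx.apply_left self_mem_Ici]

variable {S : ℝ → ℝ → Cone N → Cone N}

theorem comp_of_isSolutionOn (hf : IsLC f)
    (hS : ∀ s (x₀ : Cone N), IsSolutionOn f s x₀ (Ici s) fun t => S t s x₀) {s r t : ℝ}
    (hsr : s ≤ r) (hrt : r ≤ t) (x : Cone N) : S t s x = S t r (S r s x) := by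
  have hrestart := (((hS s x).isPrimitiveOn (hsr.trans hrt) Icc_subset_Ici_self).mono
    ⟨hsr, hrt⟩ (right_mem_Icc.2 (hsr.trans hrt))).isSolutionOn
  exact Subtype.ext (hrestart.eq_of_isLC hf hrt ((hS r (S r s x)).mono Icc_subset_Ici_self))

theorem exists_norm_sub_max_le (hf : IsLC f) (hA2 : CondA2 f A b)
    (hS : ∀ s (x₀ : Cone N), IsSolutionOn f s x₀ (Ici s) fun t => S t s x₀) (a c V : ℝ) :
    ∃ (m : ℝ → ℝ) (C : ℝ), LocallyIntegrable m volume ∧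
      ∀ s ∈ Icc a c, ∀ s' ∈ Icc a c, ∀ t ≤ c, ∀ x x' : Cone N,
        ∑ i, (x : E N) i ≤ V → ∑ i, (x' : E N) i ≤ V →
        ‖(S (max t s) s x : E N) - S (max t s') s' x'‖ ≤
          (‖(x : E N) - x'‖ + |∫ u in s..s', m u|) * C := by
  set K := box (Fin N) (aprioriBound A (fun u => ‖b u‖) a c V)
  obtain ⟨m, hm, hm_nonneg, hmK⟩ := hf.exists_nonneg_mBound (isCompact_box _ : IsCompact K)
  obtain ⟨l, hl, hl_nonneg, hlK⟩ := hf.exists_nonneg_lBound (isCompact_box _ : IsCompact K)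
  refine ⟨m, Real.exp (∫ u in a..c, l u), hm, fun s hs s' hs' t htc x x' hx hx' => ?_⟩
  have hprim {r : ℝ} (hr : r ∈ Icc a c) (y : Cone N) :=
    (hS r y).isPrimitiveOn hr.2 Icc_subset_Ici_self
  have hbox {r : ℝ} (hr : r ∈ Icc a c) {y : Cone N} (hy : ∑ i, (y : E N) i ≤ V) :
      ∀ u ∈ Icc r c, (S u r y : E N) ∈ K :=
    hA2.mem_box_of_isSolutionOn hf (hS r y) (fun t _ => (S t r y).2) hr.1 hy
  have hself (r : ℝ) (y : Cone N) : (S r r y : E N) = y := (hS r y).apply_left self_mem_Ici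
  have hle := (hprim hs x).norm_sub_max_le (hprim hs' x') hs.2 hs'.2 htc hm hm_nonneg hl hl_nonneg
    (hmK.mono fun u hu hus => hu _ (hbox hs hx u hus))
    (hmK.mono fun u hu hus => hu _ (hbox hs' hx' u hus))
    (hlK.mono fun u hu hus hus' => hu _ (hbox hs hx u hus) _ (hbox hs' hx' u hus')) hs.1 hs'.1
  simpa only [hself] using hle

theorem continuous_max_of_isSolutionOn (hf : IsLC f) (hA2 : CondA2 f A b)
    (hS : ∀ s (x₀ : Cone N), IsSolutionOn f s x₀ (Ici s) fun t => S t s x₀) :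
    Continuous fun p : ℝ × ℝ × Cone N => (S (max p.1 p.2.1) p.2.1 p.2.2 : E N) := by
  refine continuous_iff_continuousAt.2 fun ⟨t₀, s₀, x₀⟩ => ?_
  set a := s₀ - 1
  set c := max t₀ s₀ + 1
  have has₀ : a < s₀ := sub_one_lt s₀
  have ht₀c : t₀ < c := (le_max_left _ _).trans_lt (lt_add_one _)
  have hs₀c : s₀ < c := (le_max_right _ _).trans_lt (lt_add_one _)
  obtain ⟨m, C, hm, hle⟩ := exists_norm_sub_max_le hf hA2 hS a c (∑ i, (x₀ : E N) i + 1)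
  set bound : ℝ × ℝ × Cone N → ℝ := fun p =>
    (‖(p.2.2 : E N) - x₀‖ + |∫ u in p.2.1..s₀, m u|) * C +
      ‖(S (max p.1 s₀) s₀ x₀ : E N) - S (max t₀ s₀) s₀ x₀‖
  have hbound : Continuous bound := by
    have hint : Continuous fun r : ℝ => ∫ u in r..s₀, m u := by
      simp only [fun r => intervalIntegral.integral_symm (μ := volume) (f := m) s₀ r]
      exact (intervalIntegral.continuous_primitive
        (intervalIntegrable_of_locallyIntegrable hm) s₀).neg
    have hsol : Continuous fun r : ℝ => (S (max r s₀) s₀ x₀ : E N) :=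
      (hS s₀ x₀).cont.comp_continuous (f := fun r => max r s₀) (by fun_prop)
        fun r => mem_Ici.2 (le_max_right _ _)
    have hint' := hint.comp (continuous_fst.comp (continuous_snd (X := ℝ) (Y := ℝ × Cone N)))
    have hsol' := hsol.comp (continuous_fst (X := ℝ) (Y := ℝ × Cone N))
    simp only [Function.comp_def] at hint' hsol'
    fun_prop
  have hnhds : ∀ᶠ p : ℝ × ℝ × Cone N in 𝓝 (t₀, s₀, x₀), p.1 < c ∧ p.2.1 ∈ Ioo a c ∧
      ∑ i, (p.2.2 : E N) i < ∑ i, (x₀ : E N) i + 1 := by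
    have hsum : Continuous fun p : ℝ × ℝ × Cone N => ∑ i, (p.2.2 : E N) i := by fun_prop
    have hsnd : Continuous fun p : ℝ × ℝ × Cone N => p.2.1 := by fun_prop
    exact ((continuous_fst.tendsto (t₀, s₀, x₀)).eventually_lt_const ht₀c).and
      (((hsnd.tendsto (t₀, s₀, x₀)).eventually_mem (Ioo_mem_nhds has₀ hs₀c)).and
        ((hsum.tendsto (t₀, s₀, x₀)).eventually_lt_const (lt_add_one _)))
  refine tendsto_iff_norm_sub_tendsto_zero.2 (squeeze_zero' (.of_forall fun _ => norm_nonneg _)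
    (g := bound) ?_ ?_)
  · filter_upwards [hnhds] with ⟨t, s, x⟩ ⟨htc, hs, hx⟩
    refine (norm_sub_le_norm_sub_add_norm_sub _ (S (max t s₀) s₀ x₀ : E N) _).trans ?_
    exact add_le_add_left (hle s (Ioo_subset_Icc_self hs) s₀ ⟨has₀.le, hs₀c.le⟩ t htc.le x x₀ hx.le
      (le_add_of_nonneg_right zero_le_one)) _
  · simpa [bound] using hbound.tendsto (t₀, s₀, x₀)

theorem isProcess_of_isSolutionOn (hf : IsLC f) (hA2 : CondA2 f A b)
    (hS : ∀ s (x₀ : Cone N), IsSolutionOn f s x₀ (Ici s) fun t => S t s x₀) : IsProcess S where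
  self t x := Subtype.ext ((hS t x).apply_left self_mem_Ici)
  comp _ _ _ hsr hrt x := comp_of_isSolutionOn hf hS hsr hrt x
  cont := by
    refine ((continuous_max_of_isSolutionOn hf hA2 hS).subtype_mk
      fun p => (S _ _ p.2.2).2).continuousOn.congr fun p (hp : p.2.1 ≤ p.1) => Subtype.ext ?_
    simp only [max_eq_left hp]

theorem exists_isInducedProcess (hf : IsLC f) (hA1 : CondA1 f) (hA2 : CondA2 f A b) :
    ∃ S : ℝ → ℝ → Cone N → Cone N, IsInducedProcess f S := by
  choose x hx hx_nonneg using fun (s : ℝ) (x₀ : Cone N) =>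
    exists_nonneg_isSolutionOn_Ici hf hA1 hA2 s x₀.2
  let S : ℝ → ℝ → Cone N → Cone N := fun t s x₀ =>
    ⟨x s x₀ (max t s), hx_nonneg s x₀ _ (mem_Ici.2 (le_max_right _ _))⟩
  have hS (s : ℝ) (x₀ : Cone N) : IsSolutionOn f s x₀ (Ici s) fun t => S t s x₀ :=
    .of_forall_Icc fun T hT => ((hx s x₀).mono Icc_subset_Ici_self).congr hT
      fun t ht => by simp only [S, max_eq_left ht.1]
  refine ⟨S, isProcess_of_isSolutionOn hf hA2 hS, hS, fun s T x₀ y hy t ht => ?_⟩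
  exact (hy.mono (Icc_subset_Icc_right ht.2)).eq_of_isLC hf ht.1
    ((hS s x₀).mono Icc_subset_Ici_self)

end InducedProcess

/-! ### Comparison with the linear equation -/

section LinearEquation

open Set Matrix

theorem sum_sum_mul_mul_le_entrySum_mul {ι : Type*} [Fintype ι] (A : Matrix ι ι ℝ) (x : ι → ℝ) :
    ∑ i, (∑ j, A i j * x j) * x i ≤ entrySum A * ∑ i, x i * x i := by
  have hsingle (i : ι) : x i * x i ≤ ∑ k, x k * x k :=
    Finset.single_le_sum (f := fun k => x k * x k) (fun k _ => mul_self_nonneg _)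
      (Finset.mem_univ i)
  simp only [entrySum, Finset.sum_mul]
  refine Finset.sum_le_sum fun i _ => Finset.sum_le_sum fun j _ => ?_
  have hproduct : |x j * x i| ≤ ∑ k, x k * x k :=
    abs_le.2 ⟨by nlinarith [hsingle i, hsingle j, mul_self_nonneg (x i + x j)],
      by nlinarith [hsingle i, hsingle j, mul_self_nonneg (x i - x j)]⟩
  calc A i j * x j * x i ≤ |A i j| * |x j * x i| := by
        rw [mul_assoc, ← abs_mul]
        exact le_abs_self _
    _ ≤ |A i j| * ∑ k, x k * x k := by gcongr

theorem eq_zero_of_isPrimitiveOn_mul {ι : Type*} [Fintype ι] {A : ℝ → Matrix ι ι ℝ}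
    (hA : ∀ i j, LocallyIntegrable (fun t => A t i j) volume) {w : ι → ℝ → ℝ} {s t : ℝ}
    (hst : s ≤ t) (hw : ∀ i, IsPrimitiveOn (w i) (fun u => ∑ j, A u i j * w j u) s t)
    (hws : ∀ i, w i s = 0) (i : ι) : w i t = 0 := by
  have henergy := IsPrimitiveOn.sum Finset.univ fun i _ => (hw i).mul hst (hw i)
  have hentry := intervalIntegrable_of_locallyIntegrable (locallyIntegrable_entrySum hA) s t
  have hgronwall := henergy.le_mul_exp_integral hst (hentry.const_mul 2)
    (fun u _ => mul_nonneg zero_le_two (entrySum_nonneg _))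
    (intervalIntegrable_const (c := (0 : ℝ))) (fun _ _ => le_rfl) (ae_of_all _ fun u _ => by
      have hle := sum_sum_mul_mul_le_entrySum_mul (A u) fun i => w i u
      simp only [Finset.sum_add_distrib, mul_comm (w _ u) (Finset.sum _ _)]
      linarith)
  simp only [hws, mul_zero, Finset.sum_const_zero, intervalIntegral.integral_zero, add_zero,
    zero_mul] at hgronwall
  refine mul_self_eq_zero.1 ((Finset.sum_eq_zero_iff_of_nonneg fun k _ => mul_self_nonneg _).1
    (hgronwall.antisymm (Finset.sum_nonneg fun k _ => mul_self_nonneg _)) i (Finset.mem_univ i))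

variable {N : ℕ} {A Φ : ℝ → Matrix (Fin N) (Fin N) ℝ} {b : ℝ → E N} {s t : ℝ}

namespace IsFundamentalMatrix

theorem isPrimitiveOn_apply (h : IsFundamentalMatrix A Φ)
    (hA : ∀ i j, LocallyIntegrable (fun t => A t i j) volume) (i j : Fin N) (s t : ℝ) :
    IsPrimitiveOn (fun u => Φ u i j) (fun u => (A u * Φ u) i j) s t := by
  have hint (s t : ℝ) : IntervalIntegrable (fun u => (A u * Φ u) i j) volume s t := by
    have hterm (k : Fin N) : IntervalIntegrable (fun u => A u i k * Φ u k j) volume s t :=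
      (intervalIntegrable_of_locallyIntegrable (hA i k) s t).mul_continuousOn
        (h.cont.matrix_elem k j).continuousOn
    simp only [mul_apply]
    exact ⟨integrable_finsetSum Finset.univ fun k _ => (hterm k).1,
      integrable_finsetSum Finset.univ fun k _ => (hterm k).2⟩
  refine ⟨hint s t, fun r _ => ?_⟩
  rw [h.eqn r, h.eqn s, add_assoc,
    intervalIntegral.integral_add_adjacent_intervals (hint 0 s) (hint s r)]

theorem isPrimitiveOn_mulVec (h : IsFundamentalMatrix A Φ)
    (hA : ∀ i j, LocallyIntegrable (fun t => A t i j) volume) {c γ : ℝ → Fin N → ℝ}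
    (hst : s ≤ t) (hc : ∀ j, IsPrimitiveOn (fun u => c u j) (fun u => γ u j) s t) (i : Fin N) :
    IsPrimitiveOn (fun u => (Φ u *ᵥ c u) i)
      (fun u => ∑ j, A u i j * (Φ u *ᵥ c u) j + (Φ u *ᵥ γ u) i) s t := by
  refine (IsPrimitiveOn.sum Finset.univ fun j _ =>
    (h.isPrimitiveOn_apply hA i j s t).mul hst (hc j)).congr (fun u _ => rfl) (fun u _ => ?_) hst
  have hassoc := congrFun (mulVec_mulVec (c u) (A u) (Φ u)) i
  simp only [mulVec, dotProduct] at hassoc ⊢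
  rw [Finset.sum_add_distrib, hassoc]

theorem map_zero (h : IsFundamentalMatrix A Φ) : Φ 0 = 1 := by
  ext i j
  simpa only [intervalIntegral.integral_same, add_zero] using h.eqn 0 i j

theorem det_ne_zero (h : IsFundamentalMatrix A Φ)
    (hA : ∀ i j, LocallyIntegrable (fun t => A t i j) volume) (hs : s ≤ 0) : (Φ s).det ≠ 0 := by
  intro hdet
  obtain ⟨v, hv, hΦv⟩ := exists_mulVec_eq_zero_iff.2 hdet
  have hconst (j : Fin N) : IsPrimitiveOn (fun _ => v j) (fun _ => 0) s 0 :=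
    ⟨intervalIntegrable_const, by simp⟩
  have hprim (i : Fin N) := h.isPrimitiveOn_mulVec hA (c := fun _ => v) (γ := 0) hs hconst i
  simp only [Pi.zero_apply, mulVec_zero, add_zero] at hprim
  refine hv (funext fun i => ?_)
  simpa only [h.map_zero, one_mulVec, Pi.zero_apply] using
    eq_zero_of_isPrimitiveOn_mul hA hs hprim (fun i => congrFun hΦv i) i

theorem mul_inv (h : IsFundamentalMatrix A Φ)
    (hA : ∀ i j, LocallyIntegrable (fun t => A t i j) volume) (hs : s ≤ 0) :
    Φ s * (Φ s)⁻¹ = 1 :=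
  mul_nonsing_inv _ (h.det_ne_zero hA hs).isUnit

theorem continuousOn_inv (h : IsFundamentalMatrix A Φ)
    (hA : ∀ i j, LocallyIntegrable (fun t => A t i j) volume) :
    ContinuousOn (fun u => (Φ u)⁻¹) (Iic 0) := fun u hu => by
  refine (ContinuousAt.comp (f := Φ) (continuousAt_matrix_inv _ ?_)
    h.cont.continuousAt).continuousWithinAt
  rw [Ring.inverse_eq_inv']
  exact continuousAt_inv₀ (h.det_ne_zero hA hu)

theorem intervalIntegrable_inv_mulVec (h : IsFundamentalMatrix A Φ)
    (hA : ∀ i j, LocallyIntegrable (fun t => A t i j) volume) (hb : LocallyIntegrable b volume)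
    (hst : s ≤ t) (ht : t ≤ 0) :
    IntervalIntegrable (fun u => toEuclideanCLM (n := Fin N) (𝕜 := ℝ) (Φ u)⁻¹ (b u))
      volume s t := by
  have hterm (i j : Fin N) : IntervalIntegrable (fun u => (Φ u)⁻¹ i j * b u j) volume s t := by
    refine (((IsPrimitiveOn.const_add_integral (intervalIntegrable_of_locallyIntegrable hb s t)
      0).apply j).intervalIntegrable).continuousOn_mul ?_
    rw [uIcc_of_le hst]
    exact fun u hu => ((continuous_id.matrix_elem i j).continuousAt.comp_continuousWithinAt
      (h.continuousOn_inv hA u (hu.2.trans ht))).mono fun r hr => hr.2.trans ht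
  refine ⟨Integrable.of_eval_piLp fun i => ?_, Integrable.of_eval_piLp fun i => ?_⟩ <;>
    simp only [ofLp_toEuclideanCLM, mulVec, dotProduct]
  · exact integrable_finsetSum Finset.univ fun j _ => (hterm i j).1
  · exact integrable_finsetSum Finset.univ fun j _ => (hterm i j).2

end IsFundamentalMatrix

/-- The transition operator `Φ(t) Φ(s)⁻¹` of the linear equation with fundamental matrix `Φ`, as
an operator on Euclidean space. -/
def transition (Φ : ℝ → Matrix (Fin N) (Fin N) ℝ) (t s : ℝ) : E N →L[ℝ] E N :=
  toEuclideanCLM (n := Fin N) (𝕜 := ℝ) (Φ t * (Φ s)⁻¹)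

/-- The value at time `t` of the solution of `y' = A(t) y + b(t)`, `y(s) = x₀`, by variation of
constants. -/
def linearSolution (Φ : ℝ → Matrix (Fin N) (Fin N) ℝ) (b : ℝ → E N) (s : ℝ) (x₀ : E N) (t : ℝ) :
    E N :=
  transition Φ t s x₀ + ∫ u in s..t, transition Φ t u (b u)

theorem transition_apply (x : E N) :
    transition Φ t s x = toEuclideanCLM (n := Fin N) (𝕜 := ℝ) (Φ t)
      (toEuclideanCLM (n := Fin N) (𝕜 := ℝ) (Φ s)⁻¹ x) := by
  rw [transition, map_mul, mul_apply_eq_comp]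

theorem linearSolution_left (hΦ : IsFundamentalMatrix A Φ)
    (hA : ∀ i j, LocallyIntegrable (fun t => A t i j) volume) (hs : s ≤ 0) (x₀ : E N) :
    linearSolution Φ b s x₀ s = x₀ := by
  rw [linearSolution, intervalIntegral.integral_same, add_zero, transition, hΦ.mul_inv hA hs,
    map_one, one_apply_eq_self]

theorem isPrimitiveOn_linearSolution (hΦ : IsFundamentalMatrix A Φ)
    (hA : ∀ i j, LocallyIntegrable (fun t => A t i j) volume) (hb : LocallyIntegrable b volume)
    (hst : s ≤ t) (ht : t ≤ 0) (x₀ : E N) (i : Fin N) :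
    IsPrimitiveOn (fun u => linearSolution Φ b s x₀ u i)
      (fun u => ∑ j, A u i j * linearSolution Φ b s x₀ u j + b u i) s t := by
  let L : Matrix (Fin N) (Fin N) ℝ → E N →L[ℝ] E N := toEuclideanCLM (n := Fin N) (𝕜 := ℝ)
  let c : ℝ → E N := fun u => L (Φ s)⁻¹ x₀ + ∫ r in s..u, L (Φ r)⁻¹ (b r)
  have hint {u : ℝ} (hu : u ∈ Icc s t) : IntervalIntegrable (fun r => L (Φ r)⁻¹ (b r)) volume s u :=
    hΦ.intervalIntegrable_inv_mulVec hA hb hu.1 (hu.2.trans ht)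
  have hc : IsPrimitiveOn c (fun u => L (Φ u)⁻¹ (b u)) s t :=
    IsPrimitiveOn.const_add_integral (hint (right_mem_Icc.2 hst)) (L (Φ s)⁻¹ x₀)
  have hfactor {u : ℝ} (hu : u ∈ Icc s t) : Φ u *ᵥ c u = linearSolution Φ b s x₀ u := by
    simp only [linearSolution, transition_apply]
    rw [ContinuousLinearMap.intervalIntegral_comp_comm _ (hint hu), ← map_add, ofLp_toEuclideanCLM]
  have hinhom {u : ℝ} (hu : u ∈ Icc s t) : Φ u *ᵥ L (Φ u)⁻¹ (b u) = b u := by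
    simp only [L, ofLp_toEuclideanCLM]
    rw [mulVec_mulVec, hΦ.mul_inv hA (hu.2.trans ht), one_mulVec]
  exact (hΦ.isPrimitiveOn_mulVec hA hst (fun j => hc.apply j) i).congr
    (fun u hu => congrFun (hfactor hu) i) (fun u hu => by simp only [hfactor hu, hinhom hu]) hst

theorem apply_le_linearSolution {f : ℝ → E N → E N} (hf : IsLC f) (hA2 : CondA2 f A b)
    (hΦ : IsFundamentalMatrix A Φ) (hst : s ≤ t) (ht : t ≤ 0) {x₀ : E N} {x : ℝ → E N}
    (hx : IsSolutionOn f s x₀ (Icc s t) x) (hx_nonneg : ∀ u ∈ Icc s t, ∀ i, 0 ≤ x u i)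
    (i : Fin N) : x t i ≤ linearSolution Φ b s x₀ t i := by
  have hx_prim := hx.isPrimitiveOn hst Subset.rfl
  refine sub_nonneg.1 (nonneg_of_quasiMonotone hA2.locInt_A hA2.quasiMonotone hst (fun i =>
    (isPrimitiveOn_linearSolution hΦ hA2.locInt_A hA2.locInt_b hst ht x₀ i).sub (hx_prim.apply i))
    (fun i => ?_) ?_ i)
  · rw [linearSolution_left hΦ hA2.locInt_A (hst.trans ht), hx.apply_left (left_mem_Icc.2 hst),
      sub_self]
  · filter_upwards [hA2.ae_le hf] with u hu hus i
    have hle := hu (x u) (hx_nonneg u hus) i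
    simp only [mul_sub, Finset.sum_sub_distrib]
    linarith

theorem norm_linearSolution_le {α K : ℝ} (hb : LocallyIntegrable b volume)
    (hK : ∀ u ∈ Icc s t, ‖transition Φ t u‖ ≤ K * Real.exp (-α * (t - u))) (hst : s ≤ t)
    (x₀ : E N) :
    ‖linearSolution Φ b s x₀ t‖ ≤ K * Real.exp (-α * (t - s)) * ‖x₀‖ +
      K * ∫ u in s..t, Real.exp (-α * (t - u)) * ‖b u‖ := by
  refine (norm_add_le _ _).trans (add_le_add
    ((transition Φ t s).le_of_opNorm_le (hK s (left_mem_Icc.2 hst)) x₀) ?_)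
  rw [← intervalIntegral.integral_const_mul]
  refine intervalIntegral.norm_integral_le_of_norm_le hst (ae_of_all _ fun u hu => ?_)
    (((intervalIntegrable_of_locallyIntegrable (locallyIntegrable_norm hb) s t).continuousOn_mul
      (by fun_prop)).const_mul K)
  rw [← mul_assoc]
  exact (transition Φ t u).le_of_opNorm_le (hK u (Ioc_subset_Icc_self hu)) (b u)

theorem norm_le_of_isSolutionOn {f : ℝ → E N → E N} (hf : IsLC f) (hA2 : CondA2 f A b)
    (hΦ : IsFundamentalMatrix A Φ) {α K : ℝ}
    (hK : ∀ u ∈ Icc s t, ‖transition Φ t u‖ ≤ K * Real.exp (-α * (t - u)))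
    (hst : s ≤ t) (ht : t ≤ 0) {x₀ : E N} {x : ℝ → E N}
    (hx : IsSolutionOn f s x₀ (Icc s t) x) (hx_nonneg : ∀ u ∈ Icc s t, ∀ i, 0 ≤ x u i) :
    ‖x t‖ ≤ K * Real.exp (-α * (t - s)) * ‖x₀‖ +
      K * ∫ u in s..t, Real.exp (-α * (t - u)) * ‖b u‖ := by
  refine (norm_le_norm_of_abs_apply_le fun i => ?_).trans
    (norm_linearSolution_le hA2.locInt_b hK hst x₀)
  rw [abs_of_nonneg (hx_nonneg t (right_mem_Icc.2 hst) i)]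
  exact (apply_le_linearSolution hf hA2 hΦ hst ht hx hx_nonneg i).trans (le_abs_self _)

end LinearEquation

/-! ### Pullback attractors of dissipative processes -/

section PullbackAttractor

open Set Metric Bornology

variable {X : Type*} [MetricSpace X] {S : ℝ → ℝ → X → X} {B D K : Set X} {s t τ : ℝ}

theorem IsProcess.continuous_apply (hS : IsProcess S) (hst : s ≤ t) : Continuous (S t s) :=
  hS.cont.comp_continuous (f := fun x => (t, s, x)) (by fun_prop) fun _ => hst

/-- The set `B` pullback absorbs every bounded set, uniformly for the final times in `(-∞, τ]`. -/
def AbsorbsUpTo (S : ℝ → ℝ → X → X) (B : Set X) (τ : ℝ) : Prop :=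
  ∀ D : Set X, IsBounded D →
    ∃ T : ℝ, 0 < T ∧ ∀ t s : ℝ, t ≤ τ → T ≤ s → S t (t - s) '' D ⊆ B

theorem StronglyPullbackBoundedDissipative.exists_absorbsUpTo
    (h : StronglyPullbackBoundedDissipative S τ) : ∃ B, IsBounded B ∧ AbsorbsUpTo S B τ :=
  let ⟨B, hB, habs⟩ := h
  ⟨B τ, hB.bounded τ, habs⟩

namespace AbsorbsUpTo

theorem exists_mapsTo (h : AbsorbsUpTo S B τ) (hD : IsBounded D) :
    ∃ T : ℝ, 0 < T ∧ ∀ t ≤ τ, ∀ s ≤ t - T, MapsTo (S t s) D B := by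
  obtain ⟨T, hT_pos, hT⟩ := h D hD
  refine ⟨T, hT_pos, fun t ht s hs => ?_⟩
  simpa only [sub_sub_cancel] using mapsTo_iff_image_subset.2 (hT t (t - s) ht (le_sub_comm.1 hs))

theorem eventually_mapsTo (h : AbsorbsUpTo S B τ) (hD : IsBounded D) (ht : t ≤ τ) :
    ∀ᶠ s in atBot, MapsTo (S t s) D B :=
  let ⟨T, _, hT⟩ := h.exists_mapsTo hD
  (eventually_le_atBot (t - T)).mono (hT t ht)

theorem nonempty [Nonempty X] (h : AbsorbsUpTo S B τ) : B.Nonempty := by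
  obtain ⟨x⟩ := ‹Nonempty X›
  obtain ⟨s, hs⟩ := (h.eventually_mapsTo (isBounded_singleton (x := x)) le_rfl).exists
  exact ⟨_, hs rfl⟩

theorem exists_isBounded_absorbsUpTo [ProperSpace X] (hS : IsProcess S) (hB : IsBounded B)
    (h : AbsorbsUpTo S B s) (τ : ℝ) : ∃ B', IsBounded B' ∧ AbsorbsUpTo S B' τ := by
  set flow : ℝ × X → X := fun p => S p.1 s p.2
  have hflow : ContinuousOn flow (Icc s τ ×ˢ closure B) :=
    hS.cont.comp (f := fun p : ℝ × X => (p.1, s, p.2)) (by fun_prop) fun p hp => hp.1.1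
  have hcompact := (isCompact_Icc.prod hB.isCompact_closure).image_of_continuousOn hflow
  refine ⟨B ∪ flow '' (Icc s τ ×ˢ closure B), hB.union hcompact.isBounded, fun D hD => ?_⟩
  obtain ⟨T, hT_pos, hT⟩ := h.exists_mapsTo hD
  refine ⟨T + |τ - s|, by positivity, ?_⟩
  rintro t r htτ hr _ ⟨x, hx, rfl⟩
  rcases le_total t s with hts | hst
  · exact .inl (hT t hts _ (by linarith [abs_nonneg (τ - s)]) hx)
  · have hrs : t - r ≤ s - T := by linarith [le_abs_self (τ - s)]
    rw [hS.comp (t - r) s t (by linarith) hst]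
    exact .inr ⟨(t, _), ⟨⟨hst, htτ⟩, subset_closure (hT s le_rfl _ hrs hx)⟩, rfl⟩

end AbsorbsUpTo

theorem stronglyPullbackBoundedDissipative_of_absorbsUpTo [Nonempty X]
    (h : ∀ τ, ∃ B, IsBounded B ∧ AbsorbsUpTo S B τ) (τ : ℝ) :
    StronglyPullbackBoundedDissipative S τ := by
  choose B hB habs using h
  refine ⟨B, ⟨fun t => (habs t).nonempty, hB, fun t D hD => ?_⟩, habs τ⟩
  obtain ⟨T, hT_pos, hT⟩ := habs t D hD
  exact ⟨T, hT_pos, fun s => hT t s le_rfl⟩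

theorem tendsto_semiDist_zero {l : Filter ℝ} {F : ℝ → Set X}
    (h : ∀ U : Set X, IsOpen U → B ⊆ U → ∀ᶠ s in l, F s ⊆ U) :
    Tendsto (fun s => semiDist (F s) B) l (𝓝 0) := by
  refine ENNReal.tendsto_nhds_zero.2 fun ε hε => ?_
  have hthickening : ∀ᶠ s in l, F s ⊆ {x | infEDist x B < ε} :=
    h _ (isOpen_lt continuous_infEDist continuous_const) fun x hx => by
      simpa only [mem_ofPred_eq, infEDist_zero_of_mem hx] using hε
  filter_upwards [hthickening] with s hs
  exact iSup₂_le fun x hx => (hs hx).le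

/-- The pullback omega-limit set of `B` at time `t`: the limits of `S t sₙ xₙ` with `xₙ ∈ B` and
`sₙ → -∞`. -/
def pullbackOmegaLimit (S : ℝ → ℝ → X → X) (B : Set X) (t : ℝ) : Set X :=
  omegaLimit atBot (fun s x => S t s x) B

theorem mem_pullbackOmegaLimit_iff {y : X} :
    y ∈ pullbackOmegaLimit S B t ↔
      ∀ U ∈ 𝓝 y, ∃ᶠ s in atBot, ∃ x ∈ B, S t s x ∈ U := by
  simp only [pullbackOmegaLimit, mem_omegaLimit_iff_frequently, Set.Nonempty, mem_inter_iff,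
    mem_preimage]

theorem pullbackOmegaLimit_subset_closure (hK : ∀ᶠ s in atBot, MapsTo (S t s) B K) :
    pullbackOmegaLimit S B t ⊆ closure K :=
  (omegaLimit_subset_closure_image2 _ _ _ hK).trans
    (closure_mono (image2_subset_iff.2 fun _ hs _ hx => hs hx))

theorem image_pullbackOmegaLimit_subset (hS : IsProcess S) (hst : s ≤ t) :
    S t s '' pullbackOmegaLimit S B s ⊆ pullbackOmegaLimit S B t := by
  rintro _ ⟨y, hy, rfl⟩
  refine mem_pullbackOmegaLimit_iff.2 fun U hU => ?_
  have hpreimage := (hS.continuous_apply hst).continuousAt.preimage_mem_nhds hU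
  refine ((mem_pullbackOmegaLimit_iff.1 hy _ hpreimage).and_eventually
    (eventually_le_atBot s)).mono ?_
  rintro σ ⟨⟨x, hx, hxU⟩, hσ⟩
  exact ⟨x, hx, hS.comp σ s t hσ hst x ▸ hxU⟩

theorem pullbackOmegaLimit_subset_of_pullbackAttracts {C : ℝ → Set X} (hB : IsBounded B)
    (hC : IsClosed (C t)) (hattr : PullbackAttracts S C) : pullbackOmegaLimit S B t ⊆ C t := by
  intro y hy
  rw [← hC.closure_eq, mem_closure_iff_infEDist_zero]
  refine le_antisymm (ENNReal.le_of_forall_pos_le_add fun ε hε _ => ?_) bot_le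
  have hε2 : (0 : ℝ≥0∞) < ε / 2 := by simp [hε.ne']
  obtain ⟨σ, ⟨x, hx, hxy⟩, hσ⟩ := ((mem_pullbackOmegaLimit_iff.1 hy _
    (eball_mem_nhds y hε2)).and_eventually
      (ENNReal.tendsto_nhds_zero.1 (hattr t B hB) (ε / 2) hε2)).exists
  calc infEDist y (C t) ≤ infEDist (S t σ x) (C t) + edist y (S t σ x) :=
        infEDist_le_infEDist_add_edist
    _ ≤ ε / 2 + ε / 2 := by
        gcongr
        · exact (le_iSup₂ (f := fun z (_ : z ∈ S t σ '' B) => infEDist z (C t)) _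
            (mem_image_of_mem _ hx)).trans hσ
        · exact (mem_eball'.1 hxy).le
    _ = 0 + ε := by rw [ENNReal.add_halves, zero_add]

variable [ProperSpace X]

theorem isCompact_pullbackOmegaLimit (hK : IsBounded K)
    (hBK : ∀ᶠ s in atBot, MapsTo (S t s) B K) : IsCompact (pullbackOmegaLimit S B t) :=
  hK.isCompact_closure.of_isClosed_subset (isClosed_omegaLimit _ _ _)
    (pullbackOmegaLimit_subset_closure hBK)

theorem eventually_mapsTo_of_pullbackOmegaLimit_subset (hK : IsBounded K)
    (hBK : ∀ᶠ s in atBot, MapsTo (S t s) B K) {U : Set X} (hU : IsOpen U)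
    (hsub : pullbackOmegaLimit S B t ⊆ U) : ∀ᶠ s in atBot, MapsTo (S t s) B U :=
  eventually_mapsTo_of_isCompact_absorbing_of_isOpen_of_omegaLimit_subset atBot
    (fun s x => S t s x) B hK.isCompact_closure (hBK.mono fun _ hs => hs.mono_right subset_closure)
    hU hsub

theorem pullbackOmegaLimit_subset_image (hS : IsProcess S) (hst : s ≤ t) (hK : IsBounded K)
    (hBK : ∀ᶠ r in atBot, MapsTo (S s r) B K) :
    pullbackOmegaLimit S B t ⊆ S t s '' pullbackOmegaLimit S B s := by
  intro y hy
  by_contra hy_image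
  have hcont := hS.continuous_apply hst
  obtain ⟨U, V, hU, hV, himage, hyV, hUV⟩ := SeparatedNhds.of_isCompact_isCompact
    ((isCompact_pullbackOmegaLimit hK hBK).image hcont) isCompact_singleton
    (disjoint_singleton_right.2 hy_image)
  have hmapsTo := eventually_mapsTo_of_pullbackOmegaLimit_subset hK hBK (hU.preimage hcont)
    (image_subset_iff.1 himage)
  obtain ⟨σ, ⟨x, hx, hxV⟩, hσU, hσ⟩ := ((mem_pullbackOmegaLimit_iff.1 hy V
    (hV.mem_nhds (hyV rfl))).and_eventually (hmapsTo.and (eventually_le_atBot s))).exists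
  exact hUV.le_bot ⟨hS.comp σ s t hσ hst x ▸ hσU hx, hxV⟩

theorem pullbackAttracts_pullbackOmegaLimit (hS : IsProcess S) (hB : AbsorbsUpTo S B τ)
    {K : ℝ → Set X} (hK : ∀ t, IsBounded (K t))
    (hBK : ∀ t, ∀ᶠ s in atBot, MapsTo (S t s) B (K t)) :
    PullbackAttracts S (pullbackOmegaLimit S B) := by
  refine fun t D hD => tendsto_semiDist_zero fun U hU hsub => ?_
  obtain ⟨σ, hσU, hσt, hστ⟩ := ((eventually_mapsTo_of_pullbackOmegaLimit_subset (hK t) (hBK t) hU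
    hsub).and ((eventually_le_atBot t).and (eventually_le_atBot τ))).exists
  filter_upwards [hB.eventually_mapsTo hD hστ, eventually_le_atBot σ] with s hs hsσ
  rintro _ ⟨x, hx, rfl⟩
  rw [hS.comp s σ t hsσ hσt]
  exact hσU (hs hx)

theorem exists_isPullbackAttractor_boundedInPast (hS : IsProcess S)
    (hdiss : ∀ τ, StronglyPullbackBoundedDissipative S τ) :
    ∃ 𝒜 : ℝ → Set X, IsPullbackAttractor S 𝒜 ∧ BoundedInPast 𝒜 := by
  choose K hK habs using fun τ => (hdiss τ).exists_absorbsUpTo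
  have hmapsTo {t τ : ℝ} (ht : t ≤ τ) := (habs τ).eventually_mapsTo (hK 0) ht
  refine ⟨pullbackOmegaLimit S (K 0), ?_, fun τ => ?_⟩
  · exact {
      compact := fun t => isCompact_pullbackOmegaLimit (hK t) (hmapsTo le_rfl)
      invariant := fun s t hst => (image_pullbackOmegaLimit_subset hS hst).antisymm
        (pullbackOmegaLimit_subset_image hS hst (hK s) (hmapsTo le_rfl))
      attracts := pullbackAttracts_pullbackOmegaLimit hS (habs 0) hK fun t => hmapsTo le_rfl
      minimal := fun C hC hattr t =>
        pullbackOmegaLimit_subset_of_pullbackAttracts (hK 0) (hC t) hattr }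
  · exact (hK τ).closure.subset
      (iUnion₂_subset fun t ht => pullbackOmegaLimit_subset_closure (hmapsTo ht))

end PullbackAttractor

/-! ### Dissipativity -/

section Dissipativity

open Set Metric Bornology

theorem integral_exp_mul_nat_le {g : ℝ → ℝ} (hg : LocallyIntegrable g volume)
    (hg_nonneg : ∀ t, 0 ≤ g t) {α C M : ℝ} (hα : 0 ≤ α) (hC : ∀ t, ∫ u in (t - 1)..t, g u ≤ C)
    (hM_nonneg : 0 ≤ M) (hM : Real.exp (-α) * M + C ≤ M) (n : ℕ) (t : ℝ) :
    ∫ u in (t - n)..t, Real.exp (-α * (t - u)) * g u ≤ M := by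
  have hint (r a c : ℝ) :
      IntervalIntegrable (fun u => Real.exp (-α * (r - u)) * g u) volume a c :=
    (intervalIntegrable_of_locallyIntegrable hg a c).continuousOn_mul (by fun_prop)
  induction n generalizing t with
  | zero => simpa using hM_nonneg
  | succ n ih =>
    have hshift (u : ℝ) : Real.exp (-α * (t - u)) * g u =
        Real.exp (-α) * (Real.exp (-α * (t - 1 - u)) * g u) := by
      rw [← mul_assoc, ← Real.exp_add]
      ring_nf
    have hearlier : ∫ u in (t - 1 - n)..(t - 1), Real.exp (-α * (t - u)) * g u ≤
        Real.exp (-α) * M := by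
      simp only [hshift, intervalIntegral.integral_const_mul]
      gcongr
      exact ih (t - 1)
    have hlast : ∫ u in (t - 1)..t, Real.exp (-α * (t - u)) * g u ≤ C := by
      refine (intervalIntegral.integral_mono_on (by linarith) (hint t _ _)
        (intervalIntegrable_of_locallyIntegrable hg _ _) fun u hu => ?_).trans (hC t)
      refine mul_le_of_le_one_left (hg_nonneg u) (Real.exp_le_one_iff.2 ?_)
      nlinarith [hu.2]
    have hstart : t - ((n + 1 : ℕ) : ℝ) = t - 1 - n := by
      push_cast
      ring
    rw [hstart, ← intervalIntegral.integral_add_adjacent_intervals (hint t _ (t - 1)) (hint t _ _)]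
    exact (add_le_add hearlier hlast).trans hM

theorem exists_integral_exp_mul_le {g : ℝ → ℝ} (hg : LocallyIntegrable g volume)
    (hg_nonneg : ∀ t, 0 ≤ g t) {α C : ℝ} (hα : 0 < α) (hC : ∀ t, ∫ u in (t - 1)..t, g u ≤ C) :
    ∃ M, 0 ≤ M ∧ ∀ s t, s ≤ t → ∫ u in s..t, Real.exp (-α * (t - u)) * g u ≤ M := by
  have hC_nonneg : 0 ≤ C :=
    (intervalIntegral.integral_nonneg (by norm_num) fun u _ => hg_nonneg u).trans (hC 0)
  have hgap : 0 < 1 - Real.exp (-α) := sub_pos.2 (Real.exp_lt_one_iff.2 (neg_lt_zero.2 hα))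
  -- The geometric series `C + e⁻ᵅ C + e⁻²ᵅ C + ⋯`.
  set M := C / (1 - Real.exp (-α))
  have hM_nonneg : 0 ≤ M := div_nonneg hC_nonneg hgap.le
  have hM : Real.exp (-α) * M + C ≤ M := by linarith [div_mul_cancel₀ C hgap.ne']
  refine ⟨M, hM_nonneg, fun s t hst => ?_⟩
  obtain ⟨n, hn⟩ := exists_nat_ge (t - s)
  refine (intervalIntegral.integral_mono_interval (by linarith) hst le_rfl
    (ae_of_all _ fun u => mul_nonneg (Real.exp_pos _).le (hg_nonneg u)) ?_).trans
    (integral_exp_mul_nat_le hg hg_nonneg hα.le hC hM_nonneg hM n t)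
  exact (intervalIntegrable_of_locallyIntegrable hg _ _).continuousOn_mul (by fun_prop)

variable {N : ℕ}

instance nonempty_cone : Nonempty (Cone N) :=
  ⟨0, fun _ => le_rfl⟩

instance properSpace_cone : ProperSpace (Cone N) := by
  refine ProperSpace.of_isClosed (X := E N) (s := {x | ∀ i, 0 ≤ x i}) ?_
  simp only [ofPred_forall]
  exact isClosed_iInter fun i => isClosed_le continuous_const (by fun_prop)

theorem CondA4.exists_integral_norm_le {b : ℝ → E N} (hb : CondA4 b) :
    ∃ C, ∀ t, ∫ u in (t - 1)..t, ‖b u‖ ≤ C := by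
  obtain ⟨C, hC⟩ := hb (1 / 2) (by norm_num)
  refine ⟨C, fun t => ?_⟩
  have hwindow := hC (t - 1 / 2)
  rw [intervalIntegral.integral_comp_add_right fun u => ‖b u‖] at hwindow
  convert hwindow using 2 <;> ring

theorem exists_isBounded_absorbsUpTo_zero {f : ℝ → E N → E N}
    {A : ℝ → Matrix (Fin N) (Fin N) ℝ} {b : ℝ → E N} (hf : IsLC f) (hA2 : CondA2 f A b)
    (hA3 : CondA3 A) (hA4 : CondA4 b) {S : ℝ → ℝ → Cone N → Cone N} (hS : IsInducedProcess f S) :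
    ∃ B, IsBounded B ∧ AbsorbsUpTo S B 0 := by
  obtain ⟨Φ, hΦ, α, K, hα, hK_one, hK⟩ := hA3
  obtain ⟨C, hC⟩ := hA4.exists_integral_norm_le
  obtain ⟨M, -, hM⟩ := exists_integral_exp_mul_le (locallyIntegrable_norm hA2.locInt_b)
    (fun t => norm_nonneg (b t)) hα hC
  let origin : Cone N := ⟨0, fun _ => le_rfl⟩
  have mem_ball {x : Cone N} {r : ℝ} : x ∈ closedBall origin r ↔ ‖(x : E N)‖ ≤ r := by
    rw [mem_closedBall, Subtype.dist_eq, dist_zero_right]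
  refine ⟨closedBall origin (1 + K * M), isBounded_closedBall, fun D hD => ?_⟩
  obtain ⟨ρ, hρ⟩ := hD.subset_closedBall origin
  have hdecay : Tendsto (fun s => K * Real.exp (-α * s) * ρ) atTop (𝓝 0) := by
    simpa using ((Real.tendsto_exp_atBot.comp
      (tendsto_id.const_mul_atTop_of_neg (neg_lt_zero.2 hα))).const_mul K).mul_const ρ
  obtain ⟨T, hT⟩ := eventually_atTop.1 (hdecay.eventually (ge_mem_nhds zero_lt_one))
  refine ⟨max T 1, by positivity, ?_⟩
  rintro t s ht hs _ ⟨x, hx, rfl⟩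
  have hst : t - s ≤ t := by linarith [le_max_right T 1]
  have hnorm := norm_le_of_isSolutionOn hf hA2 hΦ (fun u hu => hK u t hu.2 ht) hst ht
    ((hS.solution (t - s) x).mono Icc_subset_Ici_self) fun r _ => (S r (t - s) x).2
  rw [sub_sub_cancel] at hnorm
  refine mem_ball.2 (hnorm.trans (add_le_add ?_ ?_))
  · calc K * Real.exp (-α * s) * ‖(x : E N)‖ ≤ K * Real.exp (-α * s) * ρ := by
          gcongr
          exact mem_ball.1 (hρ hx)
      _ ≤ 1 := hT s ((le_max_left T 1).trans hs)
  · gcongr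
    exact hM _ _ hst

theorem IsInducedProcess.stronglyPullbackBoundedDissipative {f : ℝ → E N → E N}
    {A : ℝ → Matrix (Fin N) (Fin N) ℝ} {b : ℝ → E N} (hf : IsLC f) (hA2 : CondA2 f A b)
    (hA3 : CondA3 A) (hA4 : CondA4 b) {S : ℝ → ℝ → Cone N → Cone N} (hS : IsInducedProcess f S)
    (τ : ℝ) : StronglyPullbackBoundedDissipative S τ := by
  obtain ⟨B, hB, habs⟩ := exists_isBounded_absorbsUpTo_zero hf hA2 hA3 hA4 hS
  exact stronglyPullbackBoundedDissipative_of_absorbsUpTo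
    (habs.exists_isBounded_absorbsUpTo hS.process hB) τ

end Dissipativity

end PullbackCone

end

theorem mainTheorem12 (N : ℕ) (f : ℝ → PullbackCone.E N → PullbackCone.E N)
    (A : ℝ → Matrix (Fin N) (Fin N) ℝ) (b : ℝ → PullbackCone.E N)
    (hf : PullbackCone.IsLC f)
    (hA1 : PullbackCone.CondA1 f)
    (hA2 : PullbackCone.CondA2 f A b)
    (hA3 : PullbackCone.CondA3 A)
    (hA4 : PullbackCone.CondA4 b) :
    ∃ S : ℝ → ℝ → PullbackCone.Cone N → PullbackCone.Cone N,
      PullbackCone.IsInducedProcess f S ∧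
      (∀ τ : ℝ, PullbackCone.StronglyPullbackBoundedDissipative S τ) ∧
      ∃ 𝒜 : ℝ → Set (PullbackCone.Cone N),
        PullbackCone.IsPullbackAttractor S 𝒜 ∧ PullbackCone.BoundedInPast 𝒜 := by
  obtain ⟨S, hS⟩ := PullbackCone.exists_isInducedProcess hf hA1 hA2
  have hdiss := hS.stronglyPullbackBoundedDissipative hf hA2 hA3 hA4
  exact ⟨S, hS, hdiss, PullbackCone.exists_isPullbackAttractor_boundedInPast hS.process hdiss⟩
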